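/- Let $\Phi$ be a unital commutative ring containing $\frac12$. Let $L=L_1\oplus L_0\oplus L_{-1}$ be a Jordan 3-graded Lie algebra over $\Phi$, that is, a 3-graded Lie algebra with $L_0=[L_1,L_{-1}]$ such that the pair $V=(L_1,L_{-1})$ is a Jordan pair with triple product $\{x,y,z\}=[[x,y],z]$ (the Jordan pair associated to $L$). For a polarized set $X=X^+\cup X^-$ let $\mathcal L(X^+,X^-)=\mathcal L_1\oplus\mathcal L_0\oplus\mathcal L_{-1}$ be the free 3-graded Lie algebra (the variables in $X^\sigma$ have degree $\sigma1$), let $FJP(X^+,X^-)$ be the free Jordan pair, and let $Ass[X^+,X^-]$ be the free 3-graded associative algebra, i.e. the quotient of the free associative algebra on $X$ by the ideal generated by all products $x^\sigma y^\sigma$ with $x^\sigma,y^\sigma\in X^\sigma$, $\sigma=\pm$. An element $f\in\mathcal L(X^+,X^-)$ is a 3-graded polynomial identity of $L$ if it is mapped to $0$ by every Lie homomorphism $\mathcal L(X^+,X^-)\to L$ that maps $X^\sigma$ into $L_{\sigma1}$, $\sigma=\pm$. It is essential if its image in $Ass[X^+,X^-]$ is nonzero and has a monic leading term, i.e. some word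 of highest degree occurs in it with coefficient $1$. A pair $g=(g_+,g_-)$ of elements $g_\sigma\in FJP(X^+,X^-)^\sigma$ is a polynomial identity of $V$ if every homomorphism $FJP(X^+,X^-)\to V$ maps both $g_+$ and $g_-$ to $0$; it is essential if its image in the free associative pair $(Ass[X^+,X^-]_1,Ass[X^+,X^-]_{-1})$ is nonzero and has a monic leading term (of highest degree among all words in both components). Elements of $\mathcal L(X^+,X^-)_{\pm1}$ are regarded as elements of $FJP(X^+,X^-)^{\pm}$ through the canonical homomorphism $\mathcal L(X^+,X^-)\to TKK(FJP(X^+,X^-))$ that extends the identity on $X$, where $TKK(V)=V^+\oplus \mathrm{IDer}\,V\oplus V^-$ is the Tits-Kantor-Koecher algebra. Suppose that $L$ satisfies an essential 3-graded polynomial identity $f=f_1+f_0+f_{-1}\in\mathcal L(X^+,X^-)$ with $f_n\in\mathcal L(X^+,X^-)_n$. Let $y^+$ and $y^-$ be variables, of polarity $+$ and $-$, that are not among the variables $X$; i.e. let $Y=Y^+\cup Y^-$ be any polarized set with $X^\sigma\subseteq Y^\sigma$, let $y^\sigma\in Y^\sigma\setminus X^\sigma$, and regard $f$ as an element of $\mathcal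 L(Y^+,Y^-)$. Then $$g=(g_+,g_-)=\bigl(f_1+[f_0,y^+],\ f_{-1}+[f_0,y^-]\bigr)$$ is an essential Jordan polynomial in $FJP(Y^+,Y^-)$, and it is a polynomial identity of the associated Jordan pair $V$. -/

import Mathlib

noncomputable section

namespace JordanLie

universe u v w z

/-- The sign of a polarity: `true` stands for `σ = +` and `false` for `σ = -`. -/
def sgn : Bool → ℤ
  | true => 1
  | false => -1

/-! ## Jordan pairs -/

section Pairs

variable (Φ : Type u) [CommRing Φ]

/-- Quadratic products `Q_x y ∈ V^σ`, for `x ∈ V^σ` and `y ∈ V^{-σ}`, on a pair `V = (V^+, V^-)` of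
`Φ`-modules. The opposite polarity of `σ` is written as a `τ` with `σ ≠ τ`. -/
structure QuadraticPair (V : Bool → Type v) [∀ σ, AddCommGroup (V σ)] [∀ σ, Module Φ (V σ)] where
  Q : ∀ {σ τ : Bool}, σ ≠ τ → QuadraticMap Φ (V σ) (V τ →ₗ[Φ] V σ)

variable {Φ}
variable {V : Bool → Type v} [∀ σ, AddCommGroup (V σ)] [∀ σ, Module Φ (V σ)]

/-- The triple product `{x, y, z} = Q_{x,z} y = Q_{x+z} y - Q_x y - Q_z y`. -/
def QuadraticPair.tri (P : QuadraticPair Φ V) {σ τ : Bool} (h : σ ≠ τ)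
    (x : V σ) (y : V τ) (z : V σ) : V σ :=
  P.Q h (x + z) y - P.Q h x y - P.Q h z y

variable (Φ V)

/-- Jordan pairs over `Φ`. The axioms are the identities
`D_{x,y} Q_x = Q_x D_{y,x}`, `D_{Q_x y, y} = D_{x, Q_y x}`, `Q_{Q_x y} = Q_x Q_y Q_x`
in all scalar extensions. As the products are quadratic, this means that these identities hold
together with their components of degree `(2,1)` (first identity), `(3,1)` and `(2,2)` (third
identity) in `(x, z)` after the substitution of `x + z` for `x`; all other linearizations follow
from these by polarization. -/
structure JordanPair extends QuadraticPair Φ V where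
  jp1 : ∀ {σ τ : Bool} (h : σ ≠ τ) (x : V σ) (y v : V τ),
    toQuadraticPair.tri h x y (Q h x v) = Q h x (toQuadraticPair.tri h.symm y x v)
  jp1_lin : ∀ {σ τ : Bool} (h : σ ≠ τ) (x z : V σ) (y v : V τ),
    toQuadraticPair.tri h z y (Q h x v) +
        toQuadraticPair.tri h x y (toQuadraticPair.tri h x v z) =
      Q h x (toQuadraticPair.tri h.symm y z v) +
        toQuadraticPair.tri h x (toQuadraticPair.tri h.symm y x v) z
  jp2 : ∀ {σ τ : Bool} (h : σ ≠ τ) (x z : V σ) (y : V τ),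
    toQuadraticPair.tri h (Q h x y) y z = toQuadraticPair.tri h x (Q h.symm y x) z
  jp3 : ∀ {σ τ : Bool} (h : σ ≠ τ) (x : V σ) (y v : V τ),
    Q h (Q h x y) v = Q h x (Q h.symm y (Q h x v))
  jp3_lin₃₁ : ∀ {σ τ : Bool} (h : σ ≠ τ) (x z : V σ) (y v : V τ),
    toQuadraticPair.tri h (Q h x y) v (toQuadraticPair.tri h x y z) =
      Q h x (Q h.symm y (toQuadraticPair.tri h x v z)) +
        toQuadraticPair.tri h x (Q h.symm y (Q h x v)) z
  jp3_lin₂₂ : ∀ {σ τ : Bool} (h : σ ≠ τ) (x z : V σ) (y v : V τ),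
    Q h (toQuadraticPair.tri h x y z) v +
        toQuadraticPair.tri h (Q h x y) v (Q h z y) =
      Q h x (Q h.symm y (Q h z v)) + Q h z (Q h.symm y (Q h x v)) +
        toQuadraticPair.tri h x (Q h.symm y (toQuadraticPair.tri h x v z)) z

end Pairs

section PairFacts

variable {Φ : Type u} [CommRing Φ]
variable {V : Bool → Type v} [∀ σ, AddCommGroup (V σ)] [∀ σ, Module Φ (V σ)]
variable {W : Bool → Type w} [∀ σ, AddCommGroup (W σ)] [∀ σ, Module Φ (W σ)]

/-- Homomorphisms of Jordan pairs. -/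
structure JordanPairHom (P : JordanPair Φ V) (P' : JordanPair Φ W) where
  map : ∀ σ, V σ →ₗ[Φ] W σ
  map_Q : ∀ {σ τ : Bool} (h : σ ≠ τ) (x : V σ) (y : V τ),
    map σ (P.Q h x y) = P'.Q h (map σ x) (map τ y)

namespace QuadraticPair

variable (P : QuadraticPair Φ V) {σ τ : Bool} (h : σ ≠ τ)

theorem tri_eq (x : V σ) (y : V τ) (z : V σ) :
    P.tri h x y z = QuadraticMap.polarBilin (P.Q h) x z y := by
  simp [tri, QuadraticMap.polar]

theorem tri_symm (x : V σ) (y : V τ) (z : V σ) : P.tri h x y z = P.tri h z y x := by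
  simp only [tri, add_comm x z]; abel

theorem tri_add_left (x x' : V σ) (y : V τ) (z : V σ) :
    P.tri h (x + x') y z = P.tri h x y z + P.tri h x' y z := by simp [tri_eq]

theorem tri_add_mid (x : V σ) (y y' : V τ) (z : V σ) :
    P.tri h x (y + y') z = P.tri h x y z + P.tri h x y' z := by simp [tri_eq]

theorem tri_add_right (x : V σ) (y : V τ) (z z' : V σ) :
    P.tri h x y (z + z') = P.tri h x y z + P.tri h x y z' := by simp [tri_eq]

theorem tri_smul_left (a : Φ) (x : V σ) (y : V τ) (z : V σ) :
    P.tri h (a • x) y z = a • P.tri h x y z := by simp [tri_eq]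

theorem tri_smul_mid (a : Φ) (x : V σ) (y : V τ) (z : V σ) :
    P.tri h x (a • y) z = a • P.tri h x y z := by simp [tri_eq]

theorem tri_smul_right (a : Φ) (x : V σ) (y : V τ) (z : V σ) :
    P.tri h x y (a • z) = a • P.tri h x y z := by simp [tri_eq]

theorem Q_add (x z : V σ) (y : V τ) :
    P.Q h (x + z) y = P.Q h x y + P.Q h z y + P.tri h x y z := by
  simp only [tri]; abel

end QuadraticPair

namespace JordanPair

variable (P : JordanPair Φ V) {σ τ : Bool} (h : σ ≠ τ)

theorem jp2_lin (u z : V σ) (y v : V τ) :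
    P.tri h (P.Q h u y) v z + P.tri h (P.Q h u v) y z = P.tri h u (P.tri h.symm y u v) z := by
  have h1 := P.jp2 h u z (y + v)
  have h2 := P.jp2 h u z y
  have h3 := P.jp2 h u z v
  simp only [map_add, P.tri_add_left, P.tri_add_mid, P.Q_add, h2, h3] at h1
  rw [← sub_eq_zero] at h1 ⊢
  rw [← h1]; abel

theorem Q_derivation (x : V σ) (y : V τ) (u : V σ) (v : V τ) :
    P.tri h x y (P.Q h u v) + P.Q h u (P.tri h.symm y x v) =
      P.tri h (P.tri h x y u) v u := by
  have h1 := P.jp1_lin h u x v y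
  have h2 := P.jp2_lin h u x v y
  have e : P.tri h x v (P.Q h u y) = P.tri h (P.Q h u y) v x := P.tri_symm ..
  have e2 : P.tri h x y (P.Q h u v) = P.tri h (P.Q h u v) y x := P.tri_symm ..
  have e3 : P.tri h (P.tri h x y u) v u = P.tri h u v (P.tri h u y x) := by
    rw [P.tri_symm h x y u, P.tri_symm h _ v u]
  have e4 : P.tri h.symm v x y = P.tri h.symm y x v := P.tri_symm ..
  rw [e, e4, ← h2] at h1
  rw [e2, e3]
  rw [← sub_eq_zero] at h1 ⊢
  rw [← neg_eq_zero, ← h1]; abel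

/-- The five-linear identity of Jordan pairs. -/
theorem five_linear (x : V σ) (y : V τ) (u : V σ) (v : V τ) (z : V σ) :
    P.tri h x y (P.tri h u v z) =
      P.tri h (P.tri h x y u) v z - P.tri h u (P.tri h.symm y x v) z +
        P.tri h u v (P.tri h x y z) := by
  have h1 := P.Q_derivation h x y (u + z) v
  have h2 := P.Q_derivation h x y u v
  have h3 := P.Q_derivation h x y z v
  simp only [P.Q_add, P.tri_add_right, P.tri_add_left] at h1
  rw [← h2, ← h3, P.tri_symm h (P.tri h x y z) v u] at h1
  rw [← sub_eq_zero] at h1 ⊢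
  rw [← h1]; abel

end JordanPair

end PairFacts

/-- The Jordan pair `(A, A)` of an associative algebra `A`, with `Q_x y = x y x`. -/
def JordanPair.ofAssociative (Φ : Type u) [CommRing Φ] (A : Type v) [Ring A] [Algebra Φ A] :
    JordanPair Φ (fun _ => A) where
  Q _ := QuadraticMap.ofPolar
    (fun x => (LinearMap.mulRight Φ x).comp (LinearMap.mulLeft Φ x))
    (fun a x => by ext y; simp [smul_smul])
    (fun x x' y => by ext z; simp [QuadraticMap.polar]; noncomm_ring)
    (fun a x y => by
      ext z
      simp [QuadraticMap.polar, add_mul, mul_add, smul_sub, smul_add, smul_smul]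
      abel)
  jp1 _ x y v := by simp [QuadraticPair.tri, QuadraticMap.ofPolar]; noncomm_ring
  jp1_lin _ x z y v := by simp [QuadraticPair.tri, QuadraticMap.ofPolar]; noncomm_ring
  jp2 _ x z y := by simp [QuadraticPair.tri, QuadraticMap.ofPolar]; noncomm_ring
  jp3 _ x y v := by simp [QuadraticMap.ofPolar]; noncomm_ring
  jp3_lin₃₁ _ x z y v := by simp [QuadraticPair.tri, QuadraticMap.ofPolar]; noncomm_ring
  jp3_lin₂₂ _ x z y v := by simp [QuadraticPair.tri, QuadraticMap.ofPolar]; noncomm_ring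

/-! ## The free Jordan pair -/

section FreePair

variable (Φ : Type u) (X : Bool → Type w)

/-- Formal expressions in the operations of a Jordan pair and in variables from the polarized set
`X = X^+ ∪ X^-`. -/
inductive Term : Bool → Type (max u w)
  | var {σ : Bool} : X σ → Term σ
  | zero {σ : Bool} : Term σ
  | add {σ : Bool} : Term σ → Term σ → Term σ
  | neg {σ : Bool} : Term σ → Term σ
  | smul {σ : Bool} : Φ → Term σ → Term σ
  | quad {σ τ : Bool} : σ ≠ τ → Term σ → Term τ → Term σ

namespace Term

variable {Φ X}

instance (σ : Bool) : Zero (Term Φ X σ) := ⟨zero⟩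
instance (σ : Bool) : Add (Term Φ X σ) := ⟨add⟩
instance (σ : Bool) : Neg (Term Φ X σ) := ⟨neg⟩
instance (σ : Bool) : SMul Φ (Term Φ X σ) := ⟨smul⟩

/-- The expression `Q_{x+z} y - Q_x y - Q_z y`. -/
def tri {σ τ : Bool} (h : σ ≠ τ) (x : Term Φ X σ) (y : Term Φ X τ) (z : Term Φ X σ) :
    Term Φ X σ :=
  quad h (x + z) y + -quad h x y + -quad h z y

variable [CommRing Φ]

/-- The relations that hold between expressions in every Jordan pair: compatibility with the
operations, the module axioms, linearity and quadraticity of the products, and the axioms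
of Jordan pairs. -/
inductive Rel : ∀ {σ : Bool}, Term Φ X σ → Term Φ X σ → Prop
  | add_left {σ : Bool} {x x' : Term Φ X σ} (y : Term Φ X σ) : Rel x x' → Rel (x + y) (x' + y)
  | add_right {σ : Bool} (x : Term Φ X σ) {y y' : Term Φ X σ} : Rel y y' → Rel (x + y) (x + y')
  | neg {σ : Bool} {x x' : Term Φ X σ} : Rel x x' → Rel (-x) (-x')
  | smul {σ : Bool} (a : Φ) {x x' : Term Φ X σ} : Rel x x' → Rel (a • x) (a • x')
  | quad_left {σ τ : Bool} (h : σ ≠ τ) {x x' : Term Φ X σ} (y : Term Φ X τ) :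
      Rel x x' → Rel (quad h x y) (quad h x' y)
  | quad_right {σ τ : Bool} (h : σ ≠ τ) (x : Term Φ X σ) {y y' : Term Φ X τ} :
      Rel y y' → Rel (quad h x y) (quad h x y')
  | add_assoc {σ : Bool} (x y z : Term Φ X σ) : Rel (x + y + z) (x + (y + z))
  | add_comm {σ : Bool} (x y : Term Φ X σ) : Rel (x + y) (y + x)
  | zero_add {σ : Bool} (x : Term Φ X σ) : Rel (0 + x) x
  | neg_add {σ : Bool} (x : Term Φ X σ) : Rel (-x + x) 0
  | smul_add {σ : Bool} (a : Φ) (x y : Term Φ X σ) : Rel (a • (x + y)) (a • x + a • y)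
  | add_smul {σ : Bool} (a b : Φ) (x : Term Φ X σ) : Rel ((a + b) • x) (a • x + b • x)
  | mul_smul {σ : Bool} (a b : Φ) (x : Term Φ X σ) : Rel ((a * b) • x) (a • b • x)
  | one_smul {σ : Bool} (x : Term Φ X σ) : Rel ((1 : Φ) • x) x
  | quad_add {σ τ : Bool} (h : σ ≠ τ) (x : Term Φ X σ) (y y' : Term Φ X τ) :
      Rel (quad h x (y + y')) (quad h x y + quad h x y')
  | quad_smul {σ τ : Bool} (h : σ ≠ τ) (x : Term Φ X σ) (a : Φ) (y : Term Φ X τ) :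
      Rel (quad h x (a • y)) (a • quad h x y)
  | smul_quad {σ τ : Bool} (h : σ ≠ τ) (a : Φ) (x : Term Φ X σ) (y : Term Φ X τ) :
      Rel (quad h (a • x) y) ((a * a) • quad h x y)
  | tri_add {σ τ : Bool} (h : σ ≠ τ) (x x' : Term Φ X σ) (y : Term Φ X τ) (z : Term Φ X σ) :
      Rel (tri h (x + x') y z) (tri h x y z + tri h x' y z)
  | tri_smul {σ τ : Bool} (h : σ ≠ τ) (a : Φ) (x : Term Φ X σ) (y : Term Φ X τ)
      (z : Term Φ X σ) : Rel (tri h (a • x) y z) (a • tri h x y z)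
  | jp1 {σ τ : Bool} (h : σ ≠ τ) (x : Term Φ X σ) (y v : Term Φ X τ) :
      Rel (tri h x y (quad h x v)) (quad h x (tri h.symm y x v))
  | jp1_lin {σ τ : Bool} (h : σ ≠ τ) (x z : Term Φ X σ) (y v : Term Φ X τ) :
      Rel (tri h z y (quad h x v) + tri h x y (tri h x v z))
        (quad h x (tri h.symm y z v) + tri h x (tri h.symm y x v) z)
  | jp2 {σ τ : Bool} (h : σ ≠ τ) (x z : Term Φ X σ) (y : Term Φ X τ) :
      Rel (tri h (quad h x y) y z) (tri h x (quad h.symm y x) z)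
  | jp3 {σ τ : Bool} (h : σ ≠ τ) (x : Term Φ X σ) (y v : Term Φ X τ) :
      Rel (quad h (quad h x y) v) (quad h x (quad h.symm y (quad h x v)))
  | jp3_lin₃₁ {σ τ : Bool} (h : σ ≠ τ) (x z : Term Φ X σ) (y v : Term Φ X τ) :
      Rel (tri h (quad h x y) v (tri h x y z))
        (quad h x (quad h.symm y (tri h x v z)) + tri h x (quad h.symm y (quad h x v)) z)
  | jp3_lin₂₂ {σ τ : Bool} (h : σ ≠ τ) (x z : Term Φ X σ) (y v : Term Φ X τ) :
      Rel (quad h (tri h x y z) v + tri h (quad h x y) v (quad h z y))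
        (quad h x (quad h.symm y (quad h z v)) + quad h z (quad h.symm y (quad h x v)) +
          tri h x (quad h.symm y (tri h x v z)) z)

end Term

variable [CommRing Φ]

/-- The free Jordan pair `FJP(X^+, X^-)` over `Φ`; its components are
`FreeJordanPair Φ X true` and `FreeJordanPair Φ X false`. -/
def FreeJordanPair (σ : Bool) : Type (max u w) := Quot (Term.Rel (Φ := Φ) (X := X) (σ := σ))

namespace FreeJordanPair

variable {Φ X}

/-- The class of an expression. -/
def mk {σ : Bool} (t : Term Φ X σ) : FreeJordanPair Φ X σ := Quot.mk _ t

variable (Φ) in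
/-- The variables. -/
def var {σ : Bool} (x : X σ) : FreeJordanPair Φ X σ := mk (Term.var x)

instance (σ : Bool) : Zero (FreeJordanPair Φ X σ) := ⟨mk 0⟩
instance (σ : Bool) : Add (FreeJordanPair Φ X σ) :=
  ⟨Quot.map₂ (· + ·) (fun x _ _ => Term.Rel.add_right x) (fun _ _ y => Term.Rel.add_left y)⟩
instance (σ : Bool) : Neg (FreeJordanPair Φ X σ) :=
  ⟨Quot.map (- ·) (fun _ _ => Term.Rel.neg)⟩
instance (σ : Bool) : SMul Φ (FreeJordanPair Φ X σ) :=
  ⟨fun a => Quot.map (a • ·) (fun _ _ => Term.Rel.smul a)⟩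

instance (σ : Bool) : AddCommGroup (FreeJordanPair Φ X σ) :=
  { AddGroup.ofLeftAxioms
      (by rintro ⟨x⟩ ⟨y⟩ ⟨z⟩; exact Quot.sound (Term.Rel.add_assoc x y z))
      (by rintro ⟨x⟩; exact Quot.sound (Term.Rel.zero_add x))
      (by rintro ⟨x⟩; exact Quot.sound (Term.Rel.neg_add x)) with
    add_comm := by rintro ⟨x⟩ ⟨y⟩; exact Quot.sound (Term.Rel.add_comm x y) }

instance (σ : Bool) : Module Φ (FreeJordanPair Φ X σ) :=
  Module.ofMinimalAxioms
    (by rintro a ⟨x⟩ ⟨y⟩; exact Quot.sound (Term.Rel.smul_add a x y))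
    (by rintro a b ⟨x⟩; exact Quot.sound (Term.Rel.add_smul a b x))
    (by rintro a b ⟨x⟩; exact Quot.sound (Term.Rel.mul_smul a b x))
    (by rintro ⟨x⟩; exact Quot.sound (Term.Rel.one_smul x))

/-- The product `Q_x y` of the free Jordan pair. -/
def quad {σ τ : Bool} (h : σ ≠ τ) :
    FreeJordanPair Φ X σ → FreeJordanPair Φ X τ → FreeJordanPair Φ X σ :=
  Quot.map₂ (Term.quad h) (fun x _ _ => Term.Rel.quad_right h x)
    (fun _ _ y => Term.Rel.quad_left h y)

theorem mk_tri {σ τ : Bool} (h : σ ≠ τ) (x : Term Φ X σ) (y : Term Φ X τ) (z : Term Φ X σ) :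
    mk (Term.tri h x y z) =
      quad h (mk x + mk z) (mk y) - quad h (mk x) (mk y) - quad h (mk z) (mk y) := by
  rw [sub_eq_add_neg, sub_eq_add_neg]; rfl

/-- `Q_x` as a linear map. -/
def quadLin {σ τ : Bool} (h : σ ≠ τ) (x : FreeJordanPair Φ X σ) :
    FreeJordanPair Φ X τ →ₗ[Φ] FreeJordanPair Φ X σ where
  toFun := quad h x
  map_add' := by
    rcases x with ⟨x⟩; rintro ⟨y⟩ ⟨z⟩; exact Quot.sound (Term.Rel.quad_add h x y z)
  map_smul' := by
    rcases x with ⟨x⟩; rintro a ⟨y⟩; exact Quot.sound (Term.Rel.quad_smul h x a y)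

variable (Φ X) in
/-- The quadratic products of the free Jordan pair. -/
def quadraticPair : QuadraticPair Φ (FreeJordanPair Φ X) where
  Q h := QuadraticMap.ofPolar (quadLin h)
    (by
      rintro a ⟨x⟩; ext ⟨y⟩; exact Quot.sound (Term.Rel.smul_quad h a x y))
    (by
      rintro ⟨x⟩ ⟨x'⟩ ⟨z⟩; ext ⟨y⟩
      have := Quot.sound (Term.Rel.tri_add h x x' y z)
      change (mk _ : FreeJordanPair Φ X _) = mk _ + mk _ at this
      rw [mk_tri, mk_tri, mk_tri] at this
      exact this)
    (by
      rintro a ⟨x⟩ ⟨z⟩; ext ⟨y⟩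
      have := Quot.sound (Term.Rel.tri_smul h a x y z)
      change (mk _ : FreeJordanPair Φ X _) = a • mk _ at this
      rw [mk_tri, mk_tri] at this
      exact this)

theorem mk_tri' {σ τ : Bool} (h : σ ≠ τ) (x : Term Φ X σ) (y : Term Φ X τ) (z : Term Φ X σ) :
    mk (Term.tri h x y z) = (quadraticPair Φ X).tri h (mk x) (mk y) (mk z) :=
  mk_tri h x y z

theorem mk_quad {σ τ : Bool} (h : σ ≠ τ) (x : Term Φ X σ) (y : Term Φ X τ) :
    mk (Term.quad h x y) = (quadraticPair Φ X).Q h (mk x) (mk y) := rfl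

theorem mk_add {σ : Bool} (x y : Term Φ X σ) :
    (mk (x + y) : FreeJordanPair Φ X σ) = mk x + mk y := rfl

theorem sound {σ : Bool} {x y : Term Φ X σ} (h : Term.Rel x y) :
    (mk x : FreeJordanPair Φ X σ) = mk y := Quot.sound h

variable (Φ X) in
/-- The Jordan pair structure of the free Jordan pair. -/
def pair : JordanPair Φ (FreeJordanPair Φ X) where
  toQuadraticPair := quadraticPair Φ X
  jp1 := by
    rintro σ τ h ⟨x⟩ ⟨y⟩ ⟨v⟩
    have e := sound (Term.Rel.jp1 h x y v)
    simp only [mk_tri', mk_quad] at e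
    exact e
  jp1_lin := by
    rintro σ τ h ⟨x⟩ ⟨z⟩ ⟨y⟩ ⟨v⟩
    have e := sound (Term.Rel.jp1_lin h x z y v)
    simp only [mk_tri', mk_quad, mk_add] at e
    exact e
  jp2 := by
    rintro σ τ h ⟨x⟩ ⟨z⟩ ⟨y⟩
    have e := sound (Term.Rel.jp2 h x z y)
    simp only [mk_tri', mk_quad] at e
    exact e
  jp3 := by
    rintro σ τ h ⟨x⟩ ⟨y⟩ ⟨v⟩
    have e := sound (Term.Rel.jp3 h x y v)
    simp only [mk_quad] at e
    exact e
  jp3_lin₃₁ := by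
    rintro σ τ h ⟨x⟩ ⟨z⟩ ⟨y⟩ ⟨v⟩
    have e := sound (Term.Rel.jp3_lin₃₁ h x z y v)
    simp only [mk_tri', mk_quad, mk_add] at e
    exact e
  jp3_lin₂₂ := by
    rintro σ τ h ⟨x⟩ ⟨z⟩ ⟨y⟩ ⟨v⟩
    have e := sound (Term.Rel.jp3_lin₂₂ h x z y v)
    simp only [mk_tri', mk_quad, mk_add] at e
    exact e

section Lift

variable {V : Bool → Type v} [∀ σ, AddCommGroup (V σ)] [∀ σ, Module Φ (V σ)]

/-- The value of an expression in a Jordan pair. -/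
def eval (P : JordanPair Φ V) (a : ∀ σ, X σ → V σ) : ∀ {σ : Bool}, Term Φ X σ → V σ
  | _, .var x => a _ x
  | _, .zero => 0
  | _, .add s t => eval P a s + eval P a t
  | _, .neg t => -eval P a t
  | _, .smul c t => c • eval P a t
  | _, .quad h s t => P.Q h (eval P a s) (eval P a t)

variable (P : JordanPair Φ V) (a : ∀ σ, X σ → V σ)

theorem eval_add {σ : Bool} (s t : Term Φ X σ) :
    eval P a (s + t) = eval P a s + eval P a t := rfl

theorem eval_neg {σ : Bool} (t : Term Φ X σ) : eval P a (-t) = -eval P a t := rfl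

theorem eval_zero {σ : Bool} : eval P a (0 : Term Φ X σ) = 0 := rfl

theorem eval_smul {σ : Bool} (c : Φ) (t : Term Φ X σ) :
    eval P a (c • t) = c • eval P a t := rfl

theorem eval_quad {σ τ : Bool} (h : σ ≠ τ) (s : Term Φ X σ) (t : Term Φ X τ) :
    eval P a (Term.quad h s t) = P.Q h (eval P a s) (eval P a t) := rfl

theorem eval_tri {σ τ : Bool} (h : σ ≠ τ) (x : Term Φ X σ) (y : Term Φ X τ)
    (z : Term Φ X σ) :
    eval P a (Term.tri h x y z) = P.tri h (eval P a x) (eval P a y) (eval P a z) := by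
  simp only [Term.tri, eval_add, eval_neg, eval_quad, QuadraticPair.tri, sub_eq_add_neg]

theorem eval_rel {σ : Bool} {s t : Term Φ X σ} (h : Term.Rel s t) :
    eval P a s = eval P a t := by
  induction h with
  | add_left y _ ih => simp only [eval_add, ih]
  | add_right y _ ih => simp only [eval_add, ih]
  | neg _ ih => simp only [eval_neg, ih]
  | smul c _ ih => simp only [eval_smul, ih]
  | quad_left h y _ ih => simp only [eval_quad, ih]
  | quad_right h x _ ih => simp only [eval_quad, ih]
  | add_assoc x y z => exact _root_.add_assoc _ _ _
  | add_comm x y => exact _root_.add_comm _ _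
  | zero_add x => exact _root_.zero_add _
  | neg_add x => exact neg_add_cancel _
  | smul_add c x y => exact _root_.smul_add _ _ _
  | add_smul c d x => exact _root_.add_smul _ _ _
  | mul_smul c d x => exact SemigroupAction.mul_smul _ _ _
  | one_smul x => exact _root_.one_smul _ _
  | quad_add h x y y' => simp only [eval_quad, eval_add, map_add]
  | quad_smul h x c y => simp only [eval_quad, eval_smul, map_smul]
  | smul_quad h c x y =>
    simp only [eval_quad, eval_smul, QuadraticMap.map_smul, LinearMap.smul_apply]
  | tri_add h x x' y z => simp only [eval_tri, eval_add, P.tri_add_left]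
  | tri_smul h c x y z => simp only [eval_tri, eval_smul, P.tri_smul_left]
  | jp1 h x y v => simpa only [eval_tri, eval_quad, eval_add] using P.jp1 h _ _ _
  | jp1_lin h x z y v => simpa only [eval_tri, eval_quad, eval_add] using P.jp1_lin h _ _ _ _
  | jp2 h x z y => simpa only [eval_tri, eval_quad, eval_add] using P.jp2 h _ _ _
  | jp3 h x y v => simpa only [eval_tri, eval_quad, eval_add] using P.jp3 h _ _ _
  | jp3_lin₃₁ h x z y v =>
    simpa only [eval_tri, eval_quad, eval_add] using P.jp3_lin₃₁ h _ _ _ _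
  | jp3_lin₂₂ h x z y v =>
    simpa only [eval_tri, eval_quad, eval_add] using P.jp3_lin₂₂ h _ _ _ _

/-- The universal property of the free Jordan pair: the homomorphism into `P` that extends the
map `a` on the variables. -/
def lift : JordanPairHom (pair Φ X) P where
  map σ :=
    { toFun := Quot.lift (eval P a) (fun _ _ => eval_rel P a)
      map_add' := by rintro ⟨x⟩ ⟨y⟩; rfl
      map_smul' := by rintro c ⟨x⟩; rfl }
  map_Q := by rintro σ τ h ⟨x⟩ ⟨y⟩; rfl

theorem lift_var {σ : Bool} (x : X σ) : (lift P a).map σ (var Φ x) = a σ x := rfl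

theorem hom_ext {F G : JordanPairHom (pair Φ X) P}
    (H : ∀ σ (x : X σ), F.map σ (var Φ x) = G.map σ (var Φ x)) : F.map = G.map := by
  suffices ∀ {σ : Bool} (t : Term Φ X σ), F.map σ (mk t) = G.map σ (mk t) by
    funext σ; ext ⟨t⟩; exact this t
  intro σ t
  induction t with
  | var x => exact H _ x
  | zero => exact (map_zero (F.map _)).trans (map_zero (G.map _)).symm
  | add s t hs ht =>
    exact (map_add (F.map _) (mk s) (mk t)).trans
      ((congrArg₂ _ hs ht).trans (map_add (G.map _) (mk s) (mk t)).symm)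
  | neg t ht =>
    exact (map_neg (F.map _) (mk t)).trans ((congrArg _ ht).trans (map_neg (G.map _) (mk t)).symm)
  | smul c t ht =>
    exact (map_smul (F.map _) c (mk t)).trans
      ((congrArg _ ht).trans (map_smul (G.map _) c (mk t)).symm)
  | quad h s t hs ht =>
    refine (F.map_Q h (mk s) (mk t)).trans (Eq.trans ?_ (G.map_Q h (mk s) (mk t)).symm)
    rw [hs, ht]

end Lift

end FreeJordanPair

end FreePair

/-! ## 3-graded Lie algebras -/

section Graded

variable {Φ : Type u} [CommRing Φ] {L : Type v} [LieRing L] [LieAlgebra Φ L]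

/-- Submodules `L_n` with `[L_i, L_j] ⊆ L_{i+j}`, which vanish for `n ∉ {-1, 0, 1}`. -/
structure HasThreeGradedBracket (𝓛 : ℤ → Submodule Φ L) : Prop where
  lie_mem : ∀ (i j : ℤ) (x y : L), x ∈ 𝓛 i → y ∈ 𝓛 j → ⁅x, y⁆ ∈ 𝓛 (i + j)
  eq_bot : ∀ n : ℤ, n ≠ 1 → n ≠ 0 → n ≠ -1 → 𝓛 n = ⊥

/-- A 3-grading `L = L_1 ⊕ L_0 ⊕ L_{-1}` of a Lie algebra. -/
structure IsThreeGrading (𝓛 : ℤ → Submodule Φ L) : Prop extends HasThreeGradedBracket 𝓛 where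
  isInternal : DirectSum.IsInternal 𝓛

/-- The pair `(L_1, L_{-1})`. -/
abbrev GradedPair (𝓛 : ℤ → Submodule Φ L) : Bool → Type v := fun σ => 𝓛 (sgn σ)

/-- The Jordan pair structure on `(L_1, L_{-1})` has triple product `{x, y, z} = [[x, y], z]`. -/
def IsAssociatedPair (𝓛 : ℤ → Submodule Φ L) (V : JordanPair Φ (GradedPair 𝓛)) : Prop :=
  ∀ {σ τ : Bool} (h : σ ≠ τ) (x : 𝓛 (sgn σ)) (y : 𝓛 (sgn τ)) (z : 𝓛 (sgn σ)),
    ((V.tri h x y z : 𝓛 (sgn σ)) : L) = ⁅⁅(x : L), (y : L)⁆, (z : L)⁆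

/-- A Jordan 3-grading: a 3-grading with `L_0 = [L_1, L_{-1}]` such that `(L_1, L_{-1})` is a Jordan
pair with triple product `[[x, y], z]`. -/
structure IsJordanThreeGrading (𝓛 : ℤ → Submodule Φ L) : Prop extends IsThreeGrading 𝓛 where
  zero_eq_span : 𝓛 0 = Submodule.span Φ {z | ∃ x ∈ 𝓛 1, ∃ y ∈ 𝓛 (-1), ⁅x, y⁆ = z}
  exists_pair : ∃ V : JordanPair Φ (GradedPair 𝓛), IsAssociatedPair 𝓛 V

end Graded

/-! ## The free 3-graded Lie algebra -/

section FreeLie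

variable (Φ : Type u) [CommRing Φ] (X : Bool → Type w)

/-- The free Lie algebra on the polarized set `X = X^+ ∪ X^-`. -/
abbrev FreeLie : Type (max u w) := FreeLieAlgebra Φ (Σ σ, X σ)

variable {X} in
/-- The variables of the free Lie algebra. -/
def lieVar {σ : Bool} (x : X σ) : FreeLie Φ X := FreeLieAlgebra.of Φ ⟨σ, x⟩

/-- The monomials `[x_1, [x_2, [x_3, … x_{2n}]]]`, `n ≥ 1`, in which the variables `x_{2i-1}` and
`x_{2i}` have opposite polarity for all `i`. -/
inductive PairWord : FreeLie Φ X → Prop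
  | base {σ τ : Bool} (h : σ ≠ τ) (x : X σ) (y : X τ) : PairWord ⁅lieVar Φ x, lieVar Φ y⁆
  | step {σ τ : Bool} (h : σ ≠ τ) (x : X σ) (y : X τ) {m : FreeLie Φ X} :
      PairWord m → PairWord ⁅lieVar Φ x, ⁅lieVar Φ y, m⁆⁆

/-- The monomials `[x_1, [x_2, [x_3, … x_{2n}]]]`, `n ≥ 1`, in which `x_1` and `x_2` have the same
polarity, and `x_{2i-1}` and `x_{2i}` have opposite polarity for `i ≥ 2`. -/
inductive Relator : FreeLie Φ X → Prop
  | base {σ : Bool} (x x' : X σ) : Relator ⁅lieVar Φ x, lieVar Φ x'⁆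
  | step {σ : Bool} (x x' : X σ) {m : FreeLie Φ X} :
      PairWord Φ X m → Relator ⁅lieVar Φ x, ⁅lieVar Φ x', m⁆⁆

/-- The ideal of the free Lie algebra generated by the relators. -/
def relatorIdeal : LieIdeal Φ (FreeLie Φ X) :=
  LieSubmodule.lieSpan Φ (FreeLie Φ X) {m | Relator Φ X m}

/-- The free 3-graded Lie algebra `ℒ(X^+, X^-)`. -/
abbrev FreeThreeGradedLie : Type (max u w) := FreeLie Φ X ⧸ relatorIdeal Φ X

/-- Lie monomials of the free Lie algebra and their degree for the grading in which `x ∈ X^σ` has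
degree `σ1`. -/
inductive LieMonomial : FreeLie Φ X → ℤ → Prop
  | var {σ : Bool} (x : X σ) : LieMonomial (lieVar Φ x) (sgn σ)
  | lie {m m' : FreeLie Φ X} {i j : ℤ} :
      LieMonomial m i → LieMonomial m' j → LieMonomial ⁅m, m'⁆ (i + j)

namespace FreeThreeGradedLie

variable {X} in
/-- The variables of the free 3-graded Lie algebra. -/
def var {σ : Bool} (x : X σ) : FreeThreeGradedLie Φ X :=
  LieSubmodule.Quotient.mk (lieVar Φ x)

/-- The homogeneous component `ℒ(X^+, X^-)_n`, the image of that of the free Lie algebra. -/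
def part (n : ℤ) : Submodule Φ (FreeThreeGradedLie Φ X) :=
  (Submodule.span Φ {m | LieMonomial Φ X m n}).map
    (LieSubmodule.Quotient.mk' (relatorIdeal Φ X) : FreeLie Φ X →ₗ[Φ] FreeThreeGradedLie Φ X)

variable {Φ X}
variable {L : Type v} [LieRing L] [LieAlgebra Φ L]

/-- Factor a homomorphism that vanishes on the relators. -/
def factor (F : FreeLie Φ X →ₗ⁅Φ⁆ L) (hF : ∀ m, Relator Φ X m → F m = 0) :
    FreeThreeGradedLie Φ X →ₗ⁅Φ⁆ L :=
  { Submodule.liftQ (relatorIdeal Φ X).toSubmodule (F : FreeLie Φ X →ₗ[Φ] L) (by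
      have h : relatorIdeal Φ X ≤ F.ker := by
        rw [relatorIdeal, LieSubmodule.lieSpan_le]
        intro m hm
        exact F.mem_ker.2 (hF m hm)
      intro m hm
      exact F.mem_ker.1 (h hm)) with
    map_lie' := by
      rintro ⟨m⟩ ⟨m'⟩
      exact F.map_lie m m' }

theorem factor_mk (F : FreeLie Φ X →ₗ⁅Φ⁆ L) (hF : ∀ m, Relator Φ X m → F m = 0)
    (m : FreeLie Φ X) : factor F hF (LieSubmodule.Quotient.mk m) = F m := rfl

theorem sgn_add_sgn {σ τ : Bool} (h : σ ≠ τ) : sgn σ + sgn τ = 0 := by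
  revert h; revert σ τ; decide

/-- The homomorphism into an algebra with a 3-graded bracket that sends the variables `x ∈ X^σ` to
given elements of degree `σ1`. -/
def lift (𝓛 : ℤ → Submodule Φ L) (h𝓛 : HasThreeGradedBracket 𝓛) (a : ∀ σ, X σ → L)
    (ha : ∀ σ x, a σ x ∈ 𝓛 (sgn σ)) : FreeThreeGradedLie Φ X →ₗ⁅Φ⁆ L :=
  factor (FreeLieAlgebra.lift Φ (fun x : Σ σ, X σ => a x.1 x.2)) (by
    have hv : ∀ {σ : Bool} (x : X σ),
        FreeLieAlgebra.lift Φ (fun x : Σ σ, X σ => a x.1 x.2) (lieVar Φ x) ∈ 𝓛 (sgn σ) := by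
      intro σ x
      rw [lieVar, FreeLieAlgebra.lift_of_apply]
      exact ha σ x
    have hp : ∀ m, PairWord Φ X m →
        FreeLieAlgebra.lift Φ (fun x : Σ σ, X σ => a x.1 x.2) m ∈ 𝓛 0 := by
      intro m hm
      induction hm with
      | base h x y =>
        rw [LieHom.map_lie, ← sgn_add_sgn h]
        exact h𝓛.lie_mem _ _ _ _ (hv x) (hv y)
      | step h x y _ ih =>
        rw [LieHom.map_lie, LieHom.map_lie, ← sgn_add_sgn h]
        have := h𝓛.lie_mem _ _ _ _ (hv x) (h𝓛.lie_mem _ _ _ _ (hv y) ih)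
        rwa [add_zero] at this
    have h2 : ∀ σ, 𝓛 (sgn σ + sgn σ) = ⊥ := by
      intro σ
      apply h𝓛.eq_bot <;> revert σ <;> decide
    intro m hm
    rw [← Submodule.mem_bot Φ]
    cases hm with
    | @base σ x x' =>
      rw [LieHom.map_lie, ← h2 σ]
      exact h𝓛.lie_mem _ _ _ _ (hv x) (hv x')
    | @step σ x x' m hm =>
      rw [LieHom.map_lie, LieHom.map_lie, ← h2 σ]
      have := h𝓛.lie_mem _ _ _ _ (hv x) (h𝓛.lie_mem _ _ _ _ (hv x') (hp m hm))
      rwa [add_zero] at this)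

theorem lift_var (𝓛 : ℤ → Submodule Φ L) (h𝓛 : HasThreeGradedBracket 𝓛) (a : ∀ σ, X σ → L)
    (ha : ∀ σ x, a σ x ∈ 𝓛 (sgn σ)) {σ : Bool} (x : X σ) :
    lift 𝓛 h𝓛 a ha (var Φ x) = a σ x := by
  rw [lift, var, factor_mk, lieVar, FreeLieAlgebra.lift_of_apply]

/-- The homomorphism `ℒ(X^+, X^-) → ℒ(Y^+, Y^-)` given by maps `X^σ → Y^σ`. -/
def map {Y : Bool → Type z} (i : ∀ σ, X σ → Y σ) :
    FreeThreeGradedLie Φ X →ₗ⁅Φ⁆ FreeThreeGradedLie Φ Y :=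
  factor (FreeLieAlgebra.lift Φ (fun x : Σ σ, X σ => var Φ (i x.1 x.2))) (by
    have hv : ∀ {σ : Bool} (x : X σ),
        FreeLieAlgebra.lift Φ (fun x : Σ σ, X σ => var Φ (i x.1 x.2)) (lieVar Φ x) =
          LieSubmodule.Quotient.mk (lieVar Φ (i σ x)) := by
      intro σ x
      rw [lieVar, FreeLieAlgebra.lift_of_apply]
      rfl
    have hp : ∀ m, PairWord Φ X m → ∃ m', PairWord Φ Y m' ∧
        FreeLieAlgebra.lift Φ (fun x : Σ σ, X σ => var Φ (i x.1 x.2)) m =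
          LieSubmodule.Quotient.mk m' := by
      intro m hm
      induction hm with
      | base h x y =>
        refine ⟨_, .base h (i _ x) (i _ y), ?_⟩
        rw [LieHom.map_lie, hv, hv, ← LieSubmodule.Quotient.mk_bracket]
      | step h x y _ ih =>
        obtain ⟨m', hm', e⟩ := ih
        refine ⟨_, .step h (i _ x) (i _ y) hm', ?_⟩
        rw [LieHom.map_lie, LieHom.map_lie, hv, hv, e, ← LieSubmodule.Quotient.mk_bracket,
          ← LieSubmodule.Quotient.mk_bracket]
    have hr : ∀ m, Relator Φ Y m →
        (LieSubmodule.Quotient.mk m : FreeThreeGradedLie Φ Y) = 0 := fun m hm =>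
      (LieSubmodule.Quotient.mk_eq_zero').2 (LieSubmodule.subset_lieSpan hm)
    intro m hm
    cases hm with
    | base x x' =>
      rw [LieHom.map_lie, hv, hv, ← LieSubmodule.Quotient.mk_bracket]
      exact hr _ (.base _ _)
    | step x x' hm =>
      obtain ⟨m', hm', e⟩ := hp _ hm
      rw [LieHom.map_lie, LieHom.map_lie, hv, hv, e, ← LieSubmodule.Quotient.mk_bracket,
        ← LieSubmodule.Quotient.mk_bracket]
      exact hr _ (.step _ _ hm'))

theorem map_var {Y : Bool → Type z} (i : ∀ σ, X σ → Y σ) {σ : Bool} (x : X σ) :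
    map i (var Φ x) = var Φ (i σ x) := by
  rw [map, var, factor_mk, lieVar, FreeLieAlgebra.lift_of_apply]

end FreeThreeGradedLie

end FreeLie

/-! ## The Tits-Kantor-Koecher algebra -/

section TKK

variable {Φ : Type u} [CommRing Φ]
variable {V : Bool → Type v} [∀ σ, AddCommGroup (V σ)] [∀ σ, Module Φ (V σ)]

/-- The linear map `D_{x,y} = {x, y, -}`. -/
def JordanPair.D (P : JordanPair Φ V) {σ τ : Bool} (h : σ ≠ τ) (x : V σ) (y : V τ) :
    Module.End Φ (V σ) where
  toFun := P.tri h x y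
  map_add' := P.tri_add_right h x y
  map_smul' a := P.tri_smul_right h a x y

/-- The inner derivation `δ(x, y) = (D_{x,y}, -D_{y,x})`. -/
def JordanPair.delta (P : JordanPair Φ V) (x : V true) (y : V false) :
    ∀ σ, Module.End Φ (V σ)
  | true => P.D (by decide) x y
  | false => -P.D (by decide) y x

/-- `IDer V`, spanned by the inner derivations. -/
def JordanPair.IDer (P : JordanPair Φ V) : Submodule Φ (∀ σ, Module.End Φ (V σ)) :=
  Submodule.span Φ {d | ∃ x y, P.delta x y = d}

namespace JordanPair

variable (P : JordanPair Φ V)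

theorem delta_true (x : V true) (y : V false) (z : V true) :
    P.delta x y true z = P.tri (by decide) x y z := rfl

theorem delta_false (x : V true) (y : V false) (w : V false) :
    P.delta x y false w = -P.tri (by decide) y x w := rfl

theorem delta_add_left (x x' : V true) (y : V false) :
    P.delta (x + x') y = P.delta x y + P.delta x' y := by
  funext σ; cases σ <;> ext z
  · simp only [Pi.add_apply, LinearMap.add_apply, delta_false, P.tri_add_mid]; abel
  · simp only [Pi.add_apply, LinearMap.add_apply, delta_true, P.tri_add_left]

theorem delta_add_right (x : V true) (y y' : V false) :
    P.delta x (y + y') = P.delta x y + P.delta x y' := by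
  funext σ; cases σ <;> ext z
  · simp only [Pi.add_apply, LinearMap.add_apply, delta_false, P.tri_add_left]; abel
  · simp only [Pi.add_apply, LinearMap.add_apply, delta_true, P.tri_add_mid]

theorem delta_smul_left (a : Φ) (x : V true) (y : V false) :
    P.delta (a • x) y = a • P.delta x y := by
  funext σ; cases σ <;> ext z
  · simp only [Pi.smul_apply, LinearMap.smul_apply, delta_false, P.tri_smul_mid, smul_neg]
  · simp only [Pi.smul_apply, LinearMap.smul_apply, delta_true, P.tri_smul_left]

theorem delta_smul_right (a : Φ) (x : V true) (y : V false) :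
    P.delta x (a • y) = a • P.delta x y := by
  funext σ; cases σ <;> ext z
  · simp only [Pi.smul_apply, LinearMap.smul_apply, delta_false, P.tri_smul_left, smul_neg]
  · simp only [Pi.smul_apply, LinearMap.smul_apply, delta_true, P.tri_smul_mid]

/-- The map `(x, y) ↦ δ(x, y)`. -/
def deltaLin : V true →ₗ[Φ] V false →ₗ[Φ] P.IDer :=
  LinearMap.mk₂ Φ (fun x y => ⟨P.delta x y, Submodule.subset_span ⟨x, y, rfl⟩⟩)
    (fun x x' y => Subtype.ext (P.delta_add_left x x' y))
    (fun a x y => Subtype.ext (P.delta_smul_left a x y))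
    (fun x y y' => Subtype.ext (P.delta_add_right x y y'))
    (fun a x y => Subtype.ext (P.delta_smul_right a x y))

theorem coe_deltaLin (x : V true) (y : V false) :
    ((P.deltaLin x y : P.IDer) : ∀ σ, Module.End Φ (V σ)) = P.delta x y := rfl

theorem commutator_delta (d : P.IDer) (x : V true) (y : V false) :
    d.1 * P.delta x y - P.delta x y * d.1 =
      P.delta (d.1 true x) y + P.delta x (d.1 false y) := by
  obtain ⟨d, hd⟩ := d
  induction hd using Submodule.span_induction with
  | mem d hd =>
    obtain ⟨u, v, rfl⟩ := hd
    funext σ; cases σ <;> ext z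
    · simp only [Pi.add_apply, Pi.sub_apply, Pi.mul_apply, LinearMap.add_apply,
        LinearMap.sub_apply, Module.End.mul_apply, delta_false, delta_true]
      have := P.five_linear (σ := false) (τ := true) (by decide) v u y x z
      have e1 : ∀ (a b : V false) (c : V true),
        P.tri (σ := false) (τ := true) (by decide) a c (-b) = -P.tri (by decide) a c b :=
        fun a b c => (P.D (by decide) a c).map_neg b
      have e2 : ∀ (a b : V false) (c : V true),
        P.tri (σ := false) (τ := true) (by decide) (-a) c b = -P.tri (by decide) a c b := by
        intro a b c
        rw [P.tri_symm, e1, P.tri_symm]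
      simp only [e1, e2, this]
      abel
    · simp only [Pi.add_apply, Pi.sub_apply, Pi.mul_apply, LinearMap.add_apply,
        LinearMap.sub_apply, Module.End.mul_apply, delta_false, delta_true]
      have := P.five_linear (σ := true) (τ := false) (by decide) u v x y z
      have e1 : ∀ (a b : V true) (c : V false),
        P.tri (σ := true) (τ := false) (by decide) a (-c) b = -P.tri (by decide) a c b := by
        intro a b c
        have := P.tri_smul_mid (σ := true) (τ := false) (by decide) (-1) a c b
        simpa only [neg_smul, one_smul] using this
      simp only [e1, this]
      abel
  | zero =>
    have h1 := P.delta_smul_left 0 0 y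
    have h2 := P.delta_smul_right 0 x 0
    simp only [zero_smul] at h1 h2
    simp [h1, h2]
  | add d e _ _ hd he =>
    simp only [Pi.add_apply, LinearMap.add_apply, P.delta_add_left, P.delta_add_right, add_mul,
      mul_add]
    simp only at hd he
    rw [← sub_eq_zero] at hd he ⊢
    have := congrArg₂ (· + ·) hd he
    simp only [add_zero] at this
    rw [← this]; abel
  | smul a d _ hd =>
    simp only [Pi.smul_apply, LinearMap.smul_apply, P.delta_smul_left, P.delta_smul_right,
      smul_mul_assoc, mul_smul_comm, ← smul_sub, ← smul_add]
    exact congrArg _ hd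

/-- `IDer V` is closed under commutators. -/
theorem commutator_mem (d e : P.IDer) : d.1 * e.1 - e.1 * d.1 ∈ P.IDer := by
  obtain ⟨e, he⟩ := e
  induction he using Submodule.span_induction with
  | mem e he =>
    obtain ⟨u, v, rfl⟩ := he
    rw [commutator_delta]
    exact add_mem (Submodule.subset_span ⟨_, _, rfl⟩) (Submodule.subset_span ⟨_, _, rfl⟩)
  | zero => simp
  | add a b _ _ ha hb =>
    have := add_mem ha hb
    simp only [mul_add, add_mul] at this ⊢
    convert this using 1; abel
  | smul c a _ ha =>
    have := P.IDer.smul_mem c ha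
    simpa only [smul_sub, smul_mul_assoc, mul_smul_comm] using this

/-- The Tits-Kantor-Koecher algebra `TKK(V) = V^+ ⊕ IDer V ⊕ V^-`. -/
@[ext]
structure TKK (P : JordanPair Φ V) where
  pos : V true
  der : P.IDer
  neg : V false

namespace TKK

variable {P}

/-- The identification with `V^+ × IDer V × V^-`. -/
def equivProd (P : JordanPair Φ V) : P.TKK ≃ V true × P.IDer × V false where
  toFun t := (t.pos, t.der, t.neg)
  invFun t := ⟨t.1, t.2.1, t.2.2⟩
  left_inv _ := rfl
  right_inv _ := rfl

instance : AddCommGroup P.TKK := (equivProd P).addCommGroup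
instance : Module Φ P.TKK := (equivProd P).module Φ

theorem zero_pos : (0 : P.TKK).pos = 0 := rfl
theorem zero_der : (0 : P.TKK).der = 0 := rfl
theorem zero_neg : (0 : P.TKK).neg = 0 := rfl
theorem add_pos (s t : P.TKK) : (s + t).pos = s.pos + t.pos := rfl
theorem add_der (s t : P.TKK) : (s + t).der = s.der + t.der := rfl
theorem add_neg (s t : P.TKK) : (s + t).neg = s.neg + t.neg := rfl
theorem smul_pos (a : Φ) (t : P.TKK) : (a • t).pos = a • t.pos := rfl
theorem smul_der (a : Φ) (t : P.TKK) : (a • t).der = a • t.der := rfl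
theorem smul_neg (a : Φ) (t : P.TKK) : (a • t).neg = a • t.neg := rfl

/-- The bracket determined by `[x, y] = δ(x, y)`, `[d, x] = d x`, `[d, y] = d y`,
`[d, e] = d e - e d` and `[V^+, V^+] = [V^-, V^-] = 0`. -/
instance : Bracket P.TKK P.TKK where
  bracket s t :=
    { pos := s.der.1 true t.pos - t.der.1 true s.pos
      der := P.deltaLin s.pos t.neg - P.deltaLin t.pos s.neg +
        ⟨s.der.1 * t.der.1 - t.der.1 * s.der.1, P.commutator_mem s.der t.der⟩
      neg := s.der.1 false t.neg - t.der.1 false s.neg }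

theorem lie_pos (s t : P.TKK) :
    ⁅s, t⁆.pos = s.der.1 true t.pos - t.der.1 true s.pos := rfl

theorem lie_neg (s t : P.TKK) :
    ⁅s, t⁆.neg = s.der.1 false t.neg - t.der.1 false s.neg := rfl

theorem lie_der (s t : P.TKK) :
    ⁅s, t⁆.der.1 = P.delta s.pos t.neg - P.delta t.pos s.neg +
      (s.der.1 * t.der.1 - t.der.1 * s.der.1) := rfl

theorem ext' {s t : P.TKK} (h1 : s.pos = t.pos) (h0 : s.der.1 = t.der.1) (h2 : s.neg = t.neg) :
    s = t := TKK.ext h1 (Subtype.ext h0) h2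

theorem delta_sub_left (x x' : V true) (y : V false) :
    P.delta (x - x') y = P.delta x y - P.delta x' y := by
  rw [eq_sub_iff_add_eq, ← delta_add_left, sub_add_cancel]

theorem delta_sub_right (x : V true) (y y' : V false) :
    P.delta x (y - y') = P.delta x y - P.delta x y' := by
  rw [eq_sub_iff_add_eq, ← delta_add_right, sub_add_cancel]

instance : LieRing P.TKK where
  add_lie s t r := by
    apply ext'
    · simp only [lie_pos, add_pos, add_der, Submodule.coe_add, Pi.add_apply,
        LinearMap.add_apply, map_add]
      abel
    · simp only [lie_der, add_pos, add_neg, add_der, Submodule.coe_add, delta_add_left,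
        delta_add_right, add_mul, mul_add]
      abel
    · simp only [lie_neg, add_neg, add_der, Submodule.coe_add, Pi.add_apply,
        LinearMap.add_apply, map_add]
      abel
  lie_add s t r := by
    apply ext'
    · simp only [lie_pos, add_pos, add_der, Submodule.coe_add, Pi.add_apply,
        LinearMap.add_apply, map_add]
      abel
    · simp only [lie_der, add_pos, add_neg, add_der, Submodule.coe_add, delta_add_left,
        delta_add_right, add_mul, mul_add]
      abel
    · simp only [lie_neg, add_neg, add_der, Submodule.coe_add, Pi.add_apply,
        LinearMap.add_apply, map_add]
      abel
  lie_self s := by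
    apply ext'
    · simp only [lie_pos, zero_pos, sub_self]
    · simp only [lie_der, zero_der, sub_self, add_zero, Submodule.coe_zero]
    · simp only [lie_neg, zero_neg, sub_self]
  leibniz_lie s t r := by
    apply ext'
    · simp only [lie_pos, add_pos, lie_der, Pi.add_apply, Pi.sub_apply, Pi.mul_apply,
        LinearMap.add_apply, LinearMap.sub_apply, Module.End.mul_apply, map_sub, delta_true]
      rw [P.tri_symm _ r.pos s.neg t.pos, P.tri_symm _ s.pos r.neg t.pos,
        P.tri_symm _ r.pos t.neg s.pos]
      abel
    · have h1 := P.commutator_delta s.der t.pos r.neg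
      have h2 := P.commutator_delta s.der r.pos t.neg
      have h3 := P.commutator_delta t.der s.pos r.neg
      have h4 := P.commutator_delta t.der r.pos s.neg
      have h5 := P.commutator_delta r.der s.pos t.neg
      have h6 := P.commutator_delta r.der t.pos s.neg
      simp only [lie_der, lie_pos, lie_neg, add_der, Submodule.coe_add, delta_sub_left,
        delta_sub_right, mul_add, add_mul, mul_sub, sub_mul, mul_assoc]
      rw [← sub_eq_zero] at h1 h2 h3 h4 h5 h6 ⊢
      have H := congrArg₂ (· + ·) (congrArg₂ (· - ·) (congrArg₂ (· - ·) h1 h2)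
        (congrArg₂ (· - ·) h3 h4)) (congrArg₂ (· - ·) h5 h6)
      simp only [add_zero, sub_zero] at H
      rw [← H]
      abel
    · simp only [lie_neg, add_neg, lie_der, Pi.add_apply, Pi.sub_apply, Pi.mul_apply,
        LinearMap.add_apply, LinearMap.sub_apply, Module.End.mul_apply, map_sub, delta_false]
      rw [P.tri_symm _ r.neg s.pos t.neg, P.tri_symm _ s.neg r.pos t.neg,
        P.tri_symm _ r.neg t.pos s.neg]
      abel

instance : LieAlgebra Φ P.TKK where
  lie_smul a s t := by
    apply ext'
    · simp only [lie_pos, smul_pos, smul_der, Submodule.coe_smul, Pi.smul_apply,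
        LinearMap.smul_apply, map_smul, smul_sub]
    · simp only [lie_der, smul_pos, smul_neg, smul_der, Submodule.coe_smul, delta_smul_left,
        delta_smul_right, smul_add, smul_sub, smul_mul_assoc, mul_smul_comm]
    · simp only [lie_neg, smul_neg, smul_der, Submodule.coe_smul, Pi.smul_apply,
        LinearMap.smul_apply, map_smul, smul_sub]

/-- The 3-grading with `TKK(V)_1 = V^+`, `TKK(V)_0 = IDer V`, `TKK(V)_{-1} = V^-`. -/
def part (P : JordanPair Φ V) (n : ℤ) : Submodule Φ P.TKK where
  carrier := {t | (n ≠ 1 → t.pos = 0) ∧ (n ≠ 0 → t.der = 0) ∧ (n ≠ -1 → t.neg = 0)}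
  zero_mem' := ⟨fun _ => rfl, fun _ => rfl, fun _ => rfl⟩
  add_mem' := by
    rintro s t ⟨h1, h2, h3⟩ ⟨k1, k2, k3⟩
    refine ⟨fun h => ?_, fun h => ?_, fun h => ?_⟩
    · rw [add_pos, h1 h, k1 h, add_zero]
    · rw [add_der, h2 h, k2 h, add_zero]
    · rw [add_neg, h3 h, k3 h, add_zero]
  smul_mem' := by
    rintro a t ⟨h1, h2, h3⟩
    refine ⟨fun h => ?_, fun h => ?_, fun h => ?_⟩
    · rw [smul_pos, h1 h, smul_zero]
    · rw [smul_der, h2 h, smul_zero]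
    · rw [smul_neg, h3 h, smul_zero]

theorem hasThreeGradedBracket (P : JordanPair Φ V) : HasThreeGradedBracket (part P) where
  lie_mem := by
    rintro i j s t ⟨h1, h2, h3⟩ ⟨k1, k2, k3⟩
    have hd : ∀ {n : ℤ} {r : P.TKK}, (n ≠ 0 → r.der = 0) → n = 0 ∨ r.der.1 = 0 := by
      intro n r h
      by_cases hn : n = 0
      · exact Or.inl hn
      · exact Or.inr (by rw [h hn]; rfl)
    have hp : ∀ {n : ℤ} {r : P.TKK}, (n ≠ 1 → r.pos = 0) → n = 1 ∨ r.pos = 0 :=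
      fun h => or_iff_not_imp_left.2 h
    have hm : ∀ {n : ℤ} {r : P.TKK}, (n ≠ -1 → r.neg = 0) → n = -1 ∨ r.neg = 0 :=
      fun h => or_iff_not_imp_left.2 h
    have dl : ∀ y, P.delta 0 y = 0 := fun y => by
      simpa only [zero_smul] using P.delta_smul_left 0 0 y
    have dr : ∀ x, P.delta x 0 = 0 := fun x => by
      simpa only [zero_smul] using P.delta_smul_right 0 x 0
    refine ⟨fun h => ?_, fun h => Subtype.ext ?_, fun h => ?_⟩
    · rw [lie_pos]
      have a1 : s.der.1 true t.pos = 0 := by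
        rcases hd h2 with e | e <;> rcases hp k1 with e' | e'
        · exact absurd (by omega) h
        all_goals simp [e, e']
      have a2 : t.der.1 true s.pos = 0 := by
        rcases hd k2 with e | e <;> rcases hp h1 with e' | e'
        · exact absurd (by omega) h
        all_goals simp [e, e']
      rw [a1, a2, sub_zero]
    · rw [lie_der]
      have a1 : P.delta s.pos t.neg = 0 := by
        rcases hp h1 with e | e <;> rcases hm k3 with e' | e'
        · exact absurd (by omega) h
        all_goals simp [e, e', dl, dr]
      have a2 : P.delta t.pos s.neg = 0 := by
        rcases hp k1 with e | e <;> rcases hm h3 with e' | e'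
        · exact absurd (by omega) h
        all_goals simp [e, e', dl, dr]
      have a3 : s.der.1 * t.der.1 - t.der.1 * s.der.1 = 0 := by
        rcases hd h2 with e | e <;> rcases hd k2 with e' | e'
        · exact absurd (by omega) h
        all_goals simp [e, e']
      rw [a1, a2, a3]; simp
    · rw [lie_neg]
      have a1 : s.der.1 false t.neg = 0 := by
        rcases hd h2 with e | e <;> rcases hm k3 with e' | e'
        · exact absurd (by omega) h
        all_goals simp [e, e']
      have a2 : t.der.1 false s.neg = 0 := by
        rcases hd k2 with e | e <;> rcases hm h3 with e' | e'
        · exact absurd (by omega) h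
        all_goals simp [e, e']
      rw [a1, a2, sub_zero]
  eq_bot := by
    intro n h1 h0 h2
    rw [eq_bot_iff]
    rintro t ⟨k1, k0, k2⟩
    exact TKK.ext (k1 h1) (k0 h0) (k2 h2)

/-- The inclusions `V^+ → TKK(V)` and `V^- → TKK(V)`. -/
def incl (P : JordanPair Φ V) : ∀ σ, V σ → P.TKK
  | true, x => ⟨x, 0, 0⟩
  | false, y => ⟨0, 0, y⟩

theorem incl_mem (P : JordanPair Φ V) : ∀ σ (x : V σ), incl P σ x ∈ part P (sgn σ)
  | true, _ => ⟨fun h => absurd rfl h, fun _ => rfl, fun _ => rfl⟩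
  | false, _ => ⟨fun _ => rfl, fun _ => rfl, fun h => absurd rfl h⟩

/-- The projections `TKK(V) → V^+` and `TKK(V) → V^-`. -/
def proj (P : JordanPair Φ V) : ∀ σ, P.TKK →ₗ[Φ] V σ
  | true => { toFun := TKK.pos, map_add' := add_pos, map_smul' := smul_pos }
  | false => { toFun := TKK.neg, map_add' := add_neg, map_smul' := smul_neg }

end TKK

end JordanPair

end TKK

/-! ## Polynomials and identities -/

section Polynomials

variable (Φ : Type u) [CommRing Φ] (X : Bool → Type w)

/-- The canonical homomorphism `ℒ(X^+, X^-) → TKK(FJP(X^+, X^-))` that extends the identity on the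
variables. -/
def toTKK : FreeThreeGradedLie Φ X →ₗ⁅Φ⁆ (FreeJordanPair.pair Φ X).TKK :=
  FreeThreeGradedLie.lift _ (JordanPair.TKK.hasThreeGradedBracket _)
    (fun σ x => JordanPair.TKK.incl _ σ (FreeJordanPair.var Φ x))
    (fun σ _ => JordanPair.TKK.incl_mem _ σ _)

/-- The Jordan polynomial in `FJP(X^+, X^-)^σ` given by an element of `ℒ(X^+, X^-)_{σ1}`, under the
canonical identification of `(ℒ(X^+, X^-)_1, ℒ(X^+, X^-)_{-1})` with `FJP(X^+, X^-)`: the image under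
`ℒ(X^+, X^-) → TKK(FJP(X^+, X^-))`. -/
def toJordan (σ : Bool) : FreeThreeGradedLie Φ X →ₗ[Φ] FreeJordanPair Φ X σ :=
  JordanPair.TKK.proj (FreeJordanPair.pair Φ X) σ ∘ₗ
    (toTKK Φ X : FreeThreeGradedLie Φ X →ₗ[Φ] (FreeJordanPair.pair Φ X).TKK)

/-- The relations `x^σ y^σ = 0`. -/
inductive AssRel : FreeAlgebra Φ (Σ σ, X σ) → FreeAlgebra Φ (Σ σ, X σ) → Prop
  | mk {σ : Bool} (x x' : X σ) :
      AssRel (FreeAlgebra.ι Φ ⟨σ, x⟩ * FreeAlgebra.ι Φ ⟨σ, x'⟩) 0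

/-- The free 3-graded associative algebra `Ass[X^+, X^-]`. -/
def FreeThreeGradedAss : Type (max u w) := RingQuot (AssRel Φ X)

namespace FreeThreeGradedAss

instance : Ring (FreeThreeGradedAss Φ X) := inferInstanceAs (Ring (RingQuot (AssRel Φ X)))
instance : Algebra Φ (FreeThreeGradedAss Φ X) :=
  inferInstanceAs (Algebra Φ (RingQuot (AssRel Φ X)))

variable {X}

/-- The variables. -/
def var (x : Σ σ, X σ) : FreeThreeGradedAss Φ X :=
  RingQuot.mkAlgHom Φ (AssRel Φ X) (FreeAlgebra.ι Φ x)

theorem var_mul_var {σ : Bool} (x x' : X σ) :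
    var Φ (⟨σ, x⟩ : Σ σ, X σ) * var Φ ⟨σ, x'⟩ = 0 := by
  have := RingQuot.mkAlgHom_rel Φ (AssRel.mk (Φ := Φ) x x')
  rw [map_mul, map_zero] at this
  exact this

/-- The monomial given by a word. -/
def mon (l : List (Σ σ, X σ)) : FreeThreeGradedAss Φ X := (l.map (var Φ)).prod

/-- The degree of a word for the grading in which `x ∈ X^σ` has degree `σ1`. -/
def weight (l : List (Σ σ, X σ)) : ℤ := (l.map (fun x => sgn x.1)).sum

theorem mon_eq_zero_or (x : Σ σ, X σ) (l : List (Σ σ, X σ)) :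
    mon Φ (x :: l) = 0 ∨ weight (x :: l) = 0 ∨ weight (x :: l) = sgn x.1 := by
  induction l generalizing x with
  | nil => right; right; simp [weight]
  | cons y l ih =>
    obtain ⟨σ, x⟩ := x
    obtain ⟨τ, y⟩ := y
    by_cases h : σ = τ
    · subst h
      left
      simp only [mon, List.map_cons, List.prod_cons]
      rw [← mul_assoc, var_mul_var, zero_mul]
    · have hs := FreeThreeGradedLie.sgn_add_sgn h
      have hw : weight (⟨σ, x⟩ :: ⟨τ, y⟩ :: l) = sgn σ + weight ((⟨τ, y⟩ : Σ σ, X σ) :: l) := by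
        simp [weight]
      rcases ih ⟨τ, y⟩ with h0 | h0 | h0
      · left
        have : mon Φ (⟨σ, x⟩ :: ⟨τ, y⟩ :: l) =
          var Φ ⟨σ, x⟩ * mon Φ ((⟨τ, y⟩ : Σ σ, X σ) :: l) := by simp [mon]
        rw [this, h0, mul_zero]
      · right; right
        rw [hw, h0, add_zero]
      · right; left
        rw [hw, h0, hs]

variable (X) in
/-- The homogeneous components of `Ass[X^+, X^-]`. -/
def part (n : ℤ) : Submodule Φ (FreeThreeGradedAss Φ X) :=
  Submodule.span Φ {a | ∃ l : List (Σ σ, X σ), weight l = n ∧ mon Φ l = a}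

theorem part_mul (i j : ℤ) (a b : FreeThreeGradedAss Φ X) (ha : a ∈ part Φ X i)
    (hb : b ∈ part Φ X j) : a * b ∈ part Φ X (i + j) := by
  have h := Submodule.mul_mem_mul ha hb
  rw [part, part, Submodule.span_mul_span] at h
  refine Submodule.span_mono ?_ h
  rintro _ ⟨_, ⟨l, rfl, rfl⟩, _, ⟨l', rfl, rfl⟩, rfl⟩
  exact ⟨l ++ l', by simp [weight], by simp [mon]⟩

attribute [local instance] LieRing.ofAssociativeRing LieAlgebra.ofAssociativeAlgebra

variable (X) in
theorem hasThreeGradedBracket : HasThreeGradedBracket (part Φ X) where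
  lie_mem i j a b ha hb := by
    rw [LieRing.of_associative_ring_bracket]
    refine sub_mem (part_mul Φ i j a b ha hb) ?_
    rw [add_comm]
    exact part_mul Φ j i b a hb ha
  eq_bot n h1 h0 h2 := by
    rw [part, Submodule.span_eq_bot]
    rintro _ ⟨l, rfl, rfl⟩
    cases l with
    | nil => exact absurd rfl h0
    | cons x l =>
      rcases mon_eq_zero_or Φ x l with h | h | h
      · exact h
      · exact absurd h h0
      · obtain ⟨σ, x⟩ := x
        cases σ
        · exact absurd h h2
        · exact absurd h h1

theorem var_mem_part {σ : Bool} (x : X σ) : var Φ ⟨σ, x⟩ ∈ part Φ X (sgn σ) :=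
  Submodule.subset_span ⟨[⟨σ, x⟩], by simp [weight], by simp [mon]⟩

variable (X) in
/-- The canonical homomorphism `π : ℒ(X^+, X^-) → Ass[X^+, X^-]^{(-)}` that extends the identity on
the variables; its image is the free special 3-graded Lie algebra. -/
def ofLie : FreeThreeGradedLie Φ X →ₗ⁅Φ⁆ FreeThreeGradedAss Φ X :=
  FreeThreeGradedLie.lift (part Φ X) (hasThreeGradedBracket Φ X) (fun σ x => var Φ ⟨σ, x⟩)
    (fun _ => var_mem_part Φ)

variable (X) in
/-- The canonical homomorphism from `FJP(X^+, X^-)` to the free associative pair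
`(Ass[X^+, X^-]_1, Ass[X^+, X^-]_{-1})` that extends the identity on the variables, with values written
in `Ass[X^+, X^-]`. -/
def ofJordan : JordanPairHom (FreeJordanPair.pair Φ X)
    (JordanPair.ofAssociative Φ (FreeThreeGradedAss Φ X)) :=
  FreeJordanPair.lift _ (fun σ x => var Φ ⟨σ, x⟩)

variable {Φ}

/-- An associative polynomial has a monic leading term: in its expression as a linear combination of
the basis of words with alternating polarities, some word of highest degree has coefficient `1`. -/
def HasMonicLeadingTerm (a : FreeThreeGradedAss Φ X) : Prop :=
  ∃ c : List (Σ σ, X σ) →₀ Φ,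
    (∀ l ∈ c.support, l.IsChain (fun x y => x.1 ≠ y.1)) ∧
    a = c.sum (fun l r => r • mon Φ l) ∧
    ∃ l ∈ c.support, c l = 1 ∧ ∀ l' ∈ c.support, l'.length ≤ l.length

end FreeThreeGradedAss

variable {Φ X}

/-- Essential 3-graded polynomials. -/
def IsEssential (f : FreeThreeGradedLie Φ X) : Prop :=
  FreeThreeGradedAss.ofLie Φ X f ≠ 0 ∧
    (FreeThreeGradedAss.ofLie Φ X f).HasMonicLeadingTerm

/-- Essential Jordan polynomials `g = (g_+, g_-) ∈ FJP(X^+, X^-)`. The image of `g` in the free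
associative pair is written as the sum of its two components in `Ass[X^+, X^-]`. -/
def IsEssentialJordan (g : ∀ σ, FreeJordanPair Φ X σ) : Prop :=
  let a : FreeThreeGradedAss Φ X :=
    (FreeThreeGradedAss.ofJordan Φ X).map true (g true) +
      (FreeThreeGradedAss.ofJordan Φ X).map false (g false)
  a ≠ 0 ∧ a.HasMonicLeadingTerm

/-- `f ∈ ℒ(X^+, X^-)` is a 3-graded polynomial identity of a 3-graded Lie algebra. -/
def IsGradedIdentity {L : Type v} [LieRing L] [LieAlgebra Φ L] (𝓛 : ℤ → Submodule Φ L)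
    (f : FreeThreeGradedLie Φ X) : Prop :=
  ∀ φ : FreeThreeGradedLie Φ X →ₗ⁅Φ⁆ L,
    (∀ (σ : Bool) (x : X σ), φ (FreeThreeGradedLie.var Φ x) ∈ 𝓛 (sgn σ)) → φ f = 0

/-- `g = (g_+, g_-) ∈ FJP(X^+, X^-)` is a polynomial identity of a Jordan pair. -/
def IsJordanIdentity {V : Bool → Type v} [∀ σ, AddCommGroup (V σ)] [∀ σ, Module Φ (V σ)]
    (P : JordanPair Φ V) (g : ∀ σ, FreeJordanPair Φ X σ) : Prop :=
  ∀ (F : JordanPairHom (FreeJordanPair.pair Φ X) P) (σ : Bool), F.map σ (g σ) = 0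

/-- The Jordan polynomial `(f_1 + [f_0, y^+], f_{-1} + [f_0, y^-])`. -/
def jordanPolynomial (f1 f0 fm : FreeThreeGradedLie Φ X) (y : ∀ σ, X σ) :
    ∀ σ, FreeJordanPair Φ X σ
  | true => toJordan Φ X true (f1 + ⁅f0, FreeThreeGradedLie.var Φ (y true)⁆)
  | false => toJordan Φ X false (fm + ⁅f0, FreeThreeGradedLie.var Φ (y false)⁆)

end Polynomials

end JordanLie

open JordanLie

/-! Both claims rest on one comparison (`IsTripleMap.map_toJordan`). Let the free Jordan pair map to
a Lie algebra with a 3-graded bracket so that triple products become `[[x, y], z]`. Passing from an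
element of degree `±1` of the free 3-graded Lie algebra to a Jordan polynomial and evaluating that
in the pair then agrees with evaluating the Lie element directly. An inner derivation of the pair
need not determine an element of degree `0` in the target, so the proof uses no homomorphism out of
the Tits-Kantor-Koecher algebra. It uses a relation instead: the outer components match, and the
degree `0` components act in the same way on the image of the pair. This relation is compatible with
brackets and holds on the variables, hence everywhere.

Identity: a homomorphism from the free Jordan pair to `V` prescribes values of the variables in
`L_{±1}`, hence a homomorphism from the free 3-graded Lie algebra to `L`. That homomorphism kills
`f`, and therefore `f_1`, `f_0` and `f_{-1}` separately because `L` is graded. So it kills `f_{±1} +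
[f_0, y^±]`, and the comparison transfers this to `g`.

Essentiality: the same comparison with target `Ass[Y^+, Y^-]` under commutators shows that `g` has
image `π(f_1) + π(f_{-1}) + [π(f_0), y^+ + y^-]`. The alternating words form a basis of `Ass`; those
of odd length have degree `±1` and those of even length degree `0`. Hence each odd word of `π(f)` is
kept and each even word `l` is replaced by `[l, y^+ + y^-]`. If the leading word `l₀` is odd, it
survives with coefficient `1`, since every new word contains a new variable. If `l₀` is even, it is
nonempty because Lie elements have no constant term. Then `l₀ y^τ`, with `τ` opposite to the last
polarity of `l₀`, is alternating and gets coefficient `1`. Even words grow by one letter and odd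
words do not grow, so the chosen word still has maximal length. -/

namespace JordanLie

/-! ### Comparing the Tits-Kantor-Koecher algebra with other 3-graded Lie algebras -/

section Comparison

variable {Φ : Type*} [CommRing Φ] {L : Type*} [LieRing L] [LieAlgebra Φ L]

namespace FreeThreeGradedLie

variable {X : Bool → Type*}

variable (Φ X) in
/-- The quotient map from the free Lie algebra. -/
def mkHom : FreeLie Φ X →ₗ⁅Φ⁆ FreeThreeGradedLie Φ X :=
  { (LieSubmodule.Quotient.mk' (relatorIdeal Φ X) :
      FreeLie Φ X →ₗ[Φ] FreeThreeGradedLie Φ X) with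
    map_lie' := fun {a b} => LieSubmodule.Quotient.mk_bracket _ a b }

/-- The variables generate: the free Lie algebra maps into `S` by sending variables to variables,
and followed by the inclusion this is the quotient map, which is surjective. -/
theorem mem_of_var_mem (S : LieSubalgebra Φ (FreeThreeGradedLie Φ X))
    (hS : ∀ (σ : Bool) (x : X σ), var Φ x ∈ S) (m : FreeThreeGradedLie Φ X) : m ∈ S := by
  let G : FreeLie Φ X →ₗ⁅Φ⁆ S := FreeLieAlgebra.lift Φ (fun x => ⟨var Φ x.2, hS x.1 x.2⟩)
  have h : S.incl.comp G = mkHom Φ X := by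
    ext x
    simp only [LieHom.comp_apply, G, FreeLieAlgebra.lift_of_apply]
    rfl
  obtain ⟨m, rfl⟩ := LieSubmodule.Quotient.surjective_mk' (relatorIdeal Φ X) m
  have e : mkHom Φ X m ∈ S := LieHom.congr_fun h m ▸ (G m).2
  exact e

theorem map_mem_of_mem_part {𝓛 : ℤ → Submodule Φ L} (h𝓛 : HasThreeGradedBracket 𝓛)
    (φ : FreeThreeGradedLie Φ X →ₗ⁅Φ⁆ L) (hφ : ∀ (σ : Bool) (x : X σ), φ (var Φ x) ∈ 𝓛 (sgn σ))
    {n : ℤ} {f : FreeThreeGradedLie Φ X} (hf : f ∈ part Φ X n) : φ f ∈ 𝓛 n := by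
  obtain ⟨m, hm, rfl⟩ := hf
  induction hm using Submodule.span_induction with
  | mem m hm =>
    change LieMonomial Φ X m n at hm
    induction hm with
    | var x => exact hφ _ x
    | lie _ _ h h' =>
      have := h𝓛.lie_mem _ _ _ _ h h'
      rw [← LieHom.map_lie] at this
      exact this
  | zero => simp
  | add a b _ _ ha hb => simpa using add_mem ha hb
  | smul r a _ ha => simpa using Submodule.smul_mem _ r ha

end FreeThreeGradedLie

variable {V : Bool → Type*} [∀ σ, AddCommGroup (V σ)] [∀ σ, Module Φ (V σ)]

/-- A pair of linear maps from a Jordan pair to a Lie algebra `L` with a 3-graded bracket that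
represents the triple product as `[[x, y], z]`. -/
structure IsTripleMap (P : JordanPair Φ V) (𝓛 : ℤ → Submodule Φ L) (F : ∀ σ, V σ →ₗ[Φ] L) :
    Prop where
  mem : ∀ σ x, F σ x ∈ 𝓛 (sgn σ)
  map_tri : ∀ {σ τ : Bool} (h : σ ≠ τ) (x : V σ) (y : V τ) (z : V σ),
    F σ (P.tri h x y z) = ⁅⁅F σ x, F τ y⁆, F σ z⁆

/-- `l` corresponds to `t ∈ TKK(V)`: its outer components are the images of those of `t`, and its
component of degree `0` acts on the image of `V` as that of `t` does on `V`. -/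
def Corresponds {P : JordanPair Φ V} (𝓛 : ℤ → Submodule Φ L) (F : ∀ σ, V σ →ₗ[Φ] L)
    (t : P.TKK) (l : L) : Prop :=
  ∃ d ∈ 𝓛 0, l = F true t.pos + d + F false t.neg ∧ ∀ σ z, ⁅d, F σ z⁆ = F σ (t.der.1 σ z)

namespace IsTripleMap

variable {P : JordanPair Φ V} {𝓛 : ℤ → Submodule Φ L} {F : ∀ σ, V σ →ₗ[Φ] L}

/-- The bracket has degree `±2`, where the grading vanishes. -/
theorem lie_self_degree (h𝓛 : HasThreeGradedBracket 𝓛) (hF : IsTripleMap P 𝓛 F) (σ : Bool)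
    (x y : V σ) : ⁅F σ x, F σ y⁆ = 0 := by
  have h := h𝓛.lie_mem _ _ _ _ (hF.mem σ x) (hF.mem σ y)
  rwa [h𝓛.eq_bot _ (by cases σ <;> decide) (by cases σ <;> decide) (by cases σ <;> decide),
    Submodule.mem_bot] at h

/-- The minus sign in `δ(x, y) = (D_{x,y}, -D_{y,x})` matches the skew symmetry `[x, y] = -[y, x]`
when the third argument is negative. -/
theorem lie_delta (hF : IsTripleMap P 𝓛 F) (x : V true) (y : V false) (σ : Bool) (z : V σ) :
    ⁅⁅F true x, F false y⁆, F σ z⁆ = F σ (P.delta x y σ z) := by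
  cases σ
  · rw [P.delta_false, map_neg, hF.map_tri, ← neg_lie, lie_skew]
  · rw [P.delta_true, hF.map_tri]

/-- Write `l = x + d + y` and `l' = x' + d' + y'`. The brackets `[x, x']` and `[y, y']` vanish, the
outer components of `[l, l']` come from the actions of `d` and `d'`, and the component of degree `0`
is `[x, y'] - [x', y] + [d, d']`. By the Jacobi identity the latter acts on the image of `V` as the
derivation component of `[t, t']` does. -/
theorem corresponds_lie (h𝓛 : HasThreeGradedBracket 𝓛) (hF : IsTripleMap P 𝓛 F) {t t' : P.TKK}
    {l l' : L} (h : Corresponds 𝓛 F t l) (h' : Corresponds 𝓛 F t' l') :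
    Corresponds 𝓛 F ⁅t, t'⁆ ⁅l, l'⁆ := by
  obtain ⟨d, hd, rfl, ht⟩ := h
  obtain ⟨d', hd', rfl, ht'⟩ := h'
  have hz : ∀ (x : V true) (y : V false), ⁅F true x, F false y⁆ ∈ 𝓛 0 := fun x y =>
    h𝓛.lie_mem 1 (-1) _ _ (hF.mem true x) (hF.mem false y)
  refine ⟨⁅F true t.pos, F false t'.neg⁆ - ⁅F true t'.pos, F false t.neg⁆ + ⁅d, d'⁆,
    add_mem (sub_mem (hz _ _) (hz _ _)) (h𝓛.lie_mem 0 0 _ _ hd hd'), ?_, ?_⟩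
  · simp only [add_lie, lie_add, hF.lie_self_degree h𝓛, ht, JordanPair.TKK.lie_pos, JordanPair.TKK.lie_neg, map_sub]
    rw [← lie_skew (F true t.pos) d', ← lie_skew (F false t.neg) d', ht', ht',
      ← lie_skew (F false t.neg)]
    abel
  · intro σ z
    rw [JordanPair.TKK.lie_der, add_lie, sub_lie, hF.lie_delta, hF.lie_delta, lie_lie, ht, ht', ht, ht']
    simp only [Pi.add_apply, Pi.sub_apply, Pi.mul_apply, LinearMap.add_apply,
        LinearMap.sub_apply, Module.End.mul_apply, map_add, map_sub]

theorem corresponds_incl (σ : Bool) (x : V σ) :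
    Corresponds 𝓛 F (JordanPair.TKK.incl P σ x) (F σ x) := by
  refine ⟨0, zero_mem _, ?_, fun τ z => ?_⟩
  · cases σ <;> simp [JordanPair.TKK.incl]
  · cases σ <;> simp [JordanPair.TKK.incl]

end IsTripleMap

theorem toTKK_var {X : Bool → Type*} {σ : Bool} (x : X σ) :
    toTKK Φ X (FreeThreeGradedLie.var Φ x) =
      JordanPair.TKK.incl _ σ (FreeJordanPair.var Φ x) :=
  FreeThreeGradedLie.lift_var ..

namespace IsTripleMap

variable {X : Bool → Type*} {𝓛 : ℤ → Submodule Φ L} {F : ∀ σ, FreeJordanPair Φ X σ →ₗ[Φ] L}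

/-- The elements for which the correspondence holds form a Lie subalgebra that contains the
variables. -/
theorem corresponds_toTKK (h𝓛 : HasThreeGradedBracket 𝓛)
    (hF : IsTripleMap (FreeJordanPair.pair Φ X) 𝓛 F) (φ : FreeThreeGradedLie Φ X →ₗ⁅Φ⁆ L)
    (hφ : ∀ (σ : Bool) (x : X σ),
      φ (FreeThreeGradedLie.var Φ x) = F σ (FreeJordanPair.var Φ x))
    (f : FreeThreeGradedLie Φ X) : Corresponds 𝓛 F (toTKK Φ X f) (φ f) := by
  let S : LieSubalgebra Φ (FreeThreeGradedLie Φ X) :=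
    { carrier := {f | Corresponds 𝓛 F (toTKK Φ X f) (φ f)}
      zero_mem' := ⟨0, zero_mem _, by simp [JordanPair.TKK.zero_pos, JordanPair.TKK.zero_neg], by
        simp [JordanPair.TKK.zero_der]⟩
      add_mem' := by
        rintro a b ⟨d, hd, e, h⟩ ⟨d', hd', e', h'⟩
        refine ⟨d + d', add_mem hd hd', ?_, fun σ z => ?_⟩
        · rw [map_add, map_add, e, e', JordanPair.TKK.add_pos, JordanPair.TKK.add_neg, map_add, map_add]; abel
        · rw [add_lie, h, h', map_add, JordanPair.TKK.add_der]; simp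
      smul_mem' := by
        rintro r a ⟨d, hd, e, h⟩
        refine ⟨r • d, Submodule.smul_mem _ r hd, ?_, fun σ z => ?_⟩
        · rw [map_smul, map_smul, e, JordanPair.TKK.smul_pos, JordanPair.TKK.smul_neg, map_smul, map_smul, smul_add,
            smul_add]
        · rw [smul_lie, h, map_smul, JordanPair.TKK.smul_der]; simp
      lie_mem' := by
        intro a b ha hb
        change Corresponds _ _ _ _
        rw [LieHom.map_lie, LieHom.map_lie]
        exact hF.corresponds_lie h𝓛 ha hb }
  refine FreeThreeGradedLie.mem_of_var_mem S (fun σ x => ?_) f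
  change Corresponds _ _ _ _
  rw [toTKK_var, hφ]
  exact corresponds_incl σ _

/-- On elements of degree `±1`, the identification of `ℒ(X^+, X^-)_{±1}` with `FJP(X^+, X^-)^±` is
compatible with homomorphisms. -/
theorem map_toJordan (h𝓛 : HasThreeGradedBracket 𝓛)
    (hind : ∀ a ∈ 𝓛 1, ∀ b ∈ 𝓛 0, ∀ c ∈ 𝓛 (-1), a + b + c = 0 → a = 0 ∧ b = 0 ∧ c = 0)
    (hF : IsTripleMap (FreeJordanPair.pair Φ X) 𝓛 F) (φ : FreeThreeGradedLie Φ X →ₗ⁅Φ⁆ L)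
    (hφ : ∀ (σ : Bool) (x : X σ),
      φ (FreeThreeGradedLie.var Φ x) = F σ (FreeJordanPair.var Φ x))
    {σ : Bool} {f : FreeThreeGradedLie Φ X} (hf : f ∈ FreeThreeGradedLie.part Φ X (sgn σ)) :
    F σ (toJordan Φ X σ f) = φ f := by
  obtain ⟨d, hd, e, -⟩ := hF.corresponds_toTKK h𝓛 φ hφ f
  have hm : φ f ∈ 𝓛 (sgn σ) := FreeThreeGradedLie.map_mem_of_mem_part h𝓛 φ
    (fun σ x => hφ σ x ▸ hF.mem _ _) hf
  -- `φ f` equals the sum of the components given by the correspondence and is homogeneous of degree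
  -- `σ1`. Subtracting it from the component of that degree gives a vanishing sum, and `hind` makes
  -- the difference vanish.
  cases σ
  · have := (hind _ (hF.mem true (toTKK Φ X f).pos) _ hd _
      (sub_mem (hF.mem false (toTKK Φ X f).neg) hm) (by rw [e]; abel)).2.2
    exact sub_eq_zero.1 this
  · have := (hind _ (sub_mem (hF.mem true (toTKK Φ X f).pos) hm) _ hd _
      (hF.mem false (toTKK Φ X f).neg) (by rw [e]; abel)).1
    exact sub_eq_zero.1 this

end IsTripleMap

/-! ### The homogeneous components of the free 3-graded Lie algebra -/

namespace FreeThreeGradedLie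

variable {X Y : Bool → Type*}

theorem map_mem_part (i : ∀ σ, X σ → Y σ) {n : ℤ} {f : FreeThreeGradedLie Φ X}
    (hf : f ∈ part Φ X n) : map i f ∈ part Φ Y n := by
  obtain ⟨m, hm, rfl⟩ := hf
  induction hm using Submodule.span_induction with
  | mem m hm =>
    change LieMonomial Φ X m n at hm
    -- The induction carries a monomial of the free Lie algebra on `Y` that lifts the image, since
    -- homogeneous components are defined through such lifts.
    suffices ∃ m', LieMonomial Φ Y m' n ∧
        LieSubmodule.Quotient.mk m' = map i (LieSubmodule.Quotient.mk m) from
      let ⟨m', h, e⟩ := this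
      ⟨m', Submodule.subset_span h, e⟩
    induction hm with
    | @var σ x => exact ⟨_, .var (i σ x), (map_var i x).symm⟩
    | lie _ _ h h' =>
      obtain ⟨a, ha, ea⟩ := h
      obtain ⟨b, hb, eb⟩ := h'
      refine ⟨_, .lie ha hb, ?_⟩
      rw [LieSubmodule.Quotient.mk_bracket, LieSubmodule.Quotient.mk_bracket, LieHom.map_lie,
        ea, eb]
  | zero => simp
  | add a b _ _ ha hb => simpa using add_mem ha hb
  | smul r a _ ha => simpa using Submodule.smul_mem _ r ha

theorem var_mem_part {σ : Bool} (x : X σ) : var Φ x ∈ part Φ X (sgn σ) :=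
  ⟨lieVar Φ x, Submodule.subset_span (LieMonomial.var x), rfl⟩

theorem lie_mem_part {m n : ℤ} {f g : FreeThreeGradedLie Φ X} (hf : f ∈ part Φ X m)
    (hg : g ∈ part Φ X n) : ⁅f, g⁆ ∈ part Φ X (m + n) := by
  obtain ⟨f, hf, rfl⟩ := hf
  obtain ⟨g, hg, rfl⟩ := hg
  refine ⟨⁅f, g⁆, ?_, (mkHom Φ X).map_lie f g⟩
  induction hf using Submodule.span_induction with
  | mem a ha =>
    induction hg using Submodule.span_induction with
    | mem b hb => exact Submodule.subset_span (LieMonomial.lie ha hb)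
    | zero => simp
    | add b c _ _ hb hc => rw [lie_add]; exact add_mem hb hc
    | smul r b _ hb => rw [lie_smul]; exact Submodule.smul_mem _ r hb
  | zero => simp
  | add b c _ _ hb hc => rw [add_lie]; exact add_mem hb hc
  | smul r b _ hb => rw [smul_lie]; exact Submodule.smul_mem _ r hb

end FreeThreeGradedLie

/-! ### Graded identities become identities of the associated Jordan pair -/

theorem JordanPairHom.map_tri {V W : Bool → Type*} [∀ σ, AddCommGroup (V σ)]
    [∀ σ, Module Φ (V σ)] [∀ σ, AddCommGroup (W σ)] [∀ σ, Module Φ (W σ)] {P : JordanPair Φ V}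
    {P' : JordanPair Φ W} (F : JordanPairHom P P') {σ τ : Bool} (h : σ ≠ τ) (x : V σ) (y : V τ)
    (z : V σ) : F.map σ (P.tri h x y z) = P'.tri h (F.map σ x) (F.map τ y) (F.map σ z) := by
  simp only [QuadraticPair.tri, map_sub, F.map_Q, map_add]

theorem IsThreeGrading.eq_zero_of_add_eq_zero {𝓛 : ℤ → Submodule Φ L} (h𝓛 : IsThreeGrading 𝓛) :
    ∀ a ∈ 𝓛 1, ∀ b ∈ 𝓛 0, ∀ c ∈ 𝓛 (-1), a + b + c = 0 → a = 0 ∧ b = 0 ∧ c = 0 := by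
  intro a ha b hb c hc h
  have hi := h𝓛.isInternal.submodule_iSupIndep
  have key : ∀ (n p q : ℤ), p ≠ n → q ≠ n → ∀ u ∈ 𝓛 n, ∀ v ∈ 𝓛 p, ∀ w ∈ 𝓛 q,
      u + v + w = 0 → u = 0 := by
    intro n p q hp hq u hu v hv w hw h
    refine Submodule.disjoint_def.1 (hi n) u hu ?_
    have : u = -(v + w) := eq_neg_of_add_eq_zero_left (by rw [← add_assoc]; exact h)
    rw [this]
    exact neg_mem (add_mem (Submodule.mem_iSup_of_mem p (Submodule.mem_iSup_of_mem hp hv))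
      (Submodule.mem_iSup_of_mem q (Submodule.mem_iSup_of_mem hq hw)))
  exact ⟨key 1 0 (-1) (by decide) (by decide) a ha b hb c hc h,
    key 0 1 (-1) (by decide) (by decide) b hb a ha c hc (by rw [add_comm b]; exact h),
    key (-1) 1 0 (by decide) (by decide) c hc a ha b hb (by rw [add_assoc, add_comm]; exact h)⟩

/-- Every evaluation of the Jordan polynomial in `V` is an evaluation in `L` of the Lie elements
`f_{±1} + [f_0, y^±]`, and these vanish because each component of `f` does. -/
theorem isJordanIdentity_jordanPolynomial {𝓛 : ℤ → Submodule Φ L} (h𝓛 : IsThreeGrading 𝓛)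
    (V : JordanPair Φ (GradedPair 𝓛)) (hV : IsAssociatedPair 𝓛 V) {X Y : Bool → Type*}
    {f1 f0 fm : FreeThreeGradedLie Φ X} (hf1 : f1 ∈ FreeThreeGradedLie.part Φ X 1)
    (hf0 : f0 ∈ FreeThreeGradedLie.part Φ X 0) (hfm : fm ∈ FreeThreeGradedLie.part Φ X (-1))
    (hid : IsGradedIdentity 𝓛 (f1 + f0 + fm)) (i : ∀ σ, X σ → Y σ) (y : ∀ σ, Y σ) :
    IsJordanIdentity V (jordanPolynomial (FreeThreeGradedLie.map i f1)
      (FreeThreeGradedLie.map i f0) (FreeThreeGradedLie.map i fm) y) := by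
  intro G
  have hb := h𝓛.toHasThreeGradedBracket
  let F : ∀ σ, FreeJordanPair Φ Y σ →ₗ[Φ] L := fun σ => (𝓛 (sgn σ)).subtype ∘ₗ G.map σ
  have hF : IsTripleMap (FreeJordanPair.pair Φ Y) 𝓛 F :=
    { mem := fun σ x => (G.map σ x).2
      map_tri := fun h x y z => by
        change ((G.map _ _ : 𝓛 _) : L) = _
        rw [G.map_tri]
        exact hV h _ _ _ }
  -- `φ` gives the variables of `Y` the values prescribed by `G`; its restriction along `i` is an
  -- admissible substitution for the identity `f`.
  let φ : FreeThreeGradedLie Φ Y →ₗ⁅Φ⁆ L := FreeThreeGradedLie.lift 𝓛 hb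
    (fun σ x => F σ (FreeJordanPair.var Φ x)) (fun σ x => hF.mem σ _)
  have hφ : ∀ (σ : Bool) (x : Y σ),
      φ (FreeThreeGradedLie.var Φ x) = F σ (FreeJordanPair.var Φ x) := fun σ x =>
    FreeThreeGradedLie.lift_var ..
  let ψ := φ.comp (FreeThreeGradedLie.map i)
  have hψ : ∀ (σ : Bool) (x : X σ), ψ (FreeThreeGradedLie.var Φ x) ∈ 𝓛 (sgn σ) := by
    intro σ x
    rw [LieHom.comp_apply, FreeThreeGradedLie.map_var, hφ]
    exact hF.mem _ _
  -- Only the sum of the three components is known to vanish; directness of the grading separates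
  -- them.
  have hz := hid ψ hψ
  rw [map_add, map_add] at hz
  obtain ⟨h1, h0, hm⟩ := h𝓛.eq_zero_of_add_eq_zero _
    (FreeThreeGradedLie.map_mem_of_mem_part hb ψ hψ hf1) _
    (FreeThreeGradedLie.map_mem_of_mem_part hb ψ hψ hf0) _
    (FreeThreeGradedLie.map_mem_of_mem_part hb ψ hψ hfm) hz
  rw [LieHom.comp_apply] at h1 h0 hm
  have key : ∀ {σ : Bool} {f : FreeThreeGradedLie Φ Y},
      f ∈ FreeThreeGradedLie.part Φ Y (sgn σ) → φ f = 0 → G.map σ (toJordan Φ Y σ f) = 0 :=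
    fun hf h0 => Subtype.ext
      ((hF.map_toJordan hb h𝓛.eq_zero_of_add_eq_zero φ hφ hf).trans h0)
  have hdeg := FreeThreeGradedLie.map_mem_part i hf0
  intro σ
  cases σ
  · refine key (add_mem (FreeThreeGradedLie.map_mem_part i hfm) ?_) ?_
    · simpa using FreeThreeGradedLie.lie_mem_part hdeg (FreeThreeGradedLie.var_mem_part (y false))
    · rw [map_add, LieHom.map_lie, hm, h0, zero_lie, add_zero]
  · refine key (add_mem (FreeThreeGradedLie.map_mem_part i hf1) ?_) ?_
    · simpa using FreeThreeGradedLie.lie_mem_part hdeg (FreeThreeGradedLie.var_mem_part (y true))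
    · rw [map_add, LieHom.map_lie, h1, h0, zero_lie, add_zero]

end Comparison

theorem FreeThreeGradedLie.hom_ext {Φ : Type*} [CommRing Φ] {X : Bool → Type*} {L : Type*}
    [LieRing L] [LieAlgebra Φ L] {φ ψ : FreeThreeGradedLie Φ X →ₗ⁅Φ⁆ L}
    (h : ∀ (σ : Bool) (x : X σ),
      φ (FreeThreeGradedLie.var Φ x) = ψ (FreeThreeGradedLie.var Φ x)) : φ = ψ := by
  have e : φ.comp (mkHom Φ X) = ψ.comp (mkHom Φ X) := FreeLieAlgebra.hom_ext fun x => h x.1 x.2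
  ext m
  obtain ⟨m, rfl⟩ := LieSubmodule.Quotient.surjective_mk' (relatorIdeal Φ X) m
  exact LieHom.congr_fun e m

namespace FreeThreeGradedAss

attribute [local instance] LieRing.ofAssociativeRing LieAlgebra.ofAssociativeAlgebra

/-! ### Alternating words as a basis of the free 3-graded associative algebra -/

section Words

variable (Φ : Type*) [CommRing Φ] {X : Bool → Type*}

theorem mon_append (l l' : List (Σ σ, X σ)) : mon Φ (l ++ l') = mon Φ l * mon Φ l' := by
  simp [mon]

theorem mon_cons (x : Σ σ, X σ) (l : List (Σ σ, X σ)) : mon Φ (x :: l) = var Φ x * mon Φ l := by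
  simp [mon]

theorem mon_singleton (x : Σ σ, X σ) : mon Φ [x] = var Φ x := by simp [mon]

/-- Each letter contributes `±1`, an odd number. Thus word length separates `f_0` from `f_1 +
f_{-1}`. -/
theorem even_weight (l : List (Σ σ, X σ)) : Even (weight l) ↔ Even l.length := by
  induction l with
  | nil => simp [weight]
  | cons x l ih =>
    have h : weight (x :: l) = sgn x.1 + weight l := by simp [weight]
    have hs : ¬ Even (sgn x.1) := by cases x.1 <;> decide
    rw [h, Int.even_add, ih, List.length_cons, Nat.even_add_one]
    tauto

/-- Words with alternating polarities. -/
def Alternating (l : List (Σ σ, X σ)) : Prop := l.IsChain (fun x y => x.1 ≠ y.1)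

variable {Φ} in
/-- The universal property of `Ass[X^+, X^-]`. -/
def lift {A : Type*} [Ring A] [Algebra Φ A] (a : (Σ σ, X σ) → A)
    (ha : ∀ (σ : Bool) (x x' : X σ), a ⟨σ, x⟩ * a ⟨σ, x'⟩ = 0) : FreeThreeGradedAss Φ X →ₐ[Φ] A :=
  RingQuot.liftAlgHom Φ ⟨FreeAlgebra.lift Φ a, by
    rintro _ _ ⟨x, x'⟩
    simp [ha]⟩

variable {Φ} in
theorem lift_var {A : Type*} [Ring A] [Algebra Φ A] (a : (Σ σ, X σ) → A)
    (ha : ∀ (σ : Bool) (x x' : X σ), a ⟨σ, x⟩ * a ⟨σ, x'⟩ = 0) (x : Σ σ, X σ) :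
    lift a ha (var Φ x) = a x := by
  rw [lift, var]
  exact (RingQuot.liftAlgHom_mkAlgHom_apply _ _ _ _).trans (FreeAlgebra.lift_ι_apply _ _)

open Classical in
/-- The basis vector of an alternating word, and `0` for all other words. -/
def normalWord (l : List (Σ σ, X σ)) : List (Σ σ, X σ) →₀ Φ :=
  if Alternating l then Finsupp.single l 1 else 0

/-- Left multiplication by a variable on the span of the alternating words. -/
def consMap (x : Σ σ, X σ) : Module.End Φ (List (Σ σ, X σ) →₀ Φ) :=
  Finsupp.linearCombination Φ (fun l => normalWord Φ (x :: l))

/-- If `l` is not alternating, neither is `x :: l`, and both sides are `0`. So truncating after each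
letter gives the same result as truncating once at the end. -/
theorem consMap_normalWord (x : Σ σ, X σ) (l : List (Σ σ, X σ)) :
    consMap Φ x (normalWord Φ l) = normalWord Φ (x :: l) := by
  by_cases h : Alternating l
  · simp [consMap, normalWord, h]
  · have : ¬ Alternating (x :: l) := fun k => h k.of_cons
    simp [normalWord, h, this]

variable (X) in
/-- The action of `Ass[X^+, X^-]` on the span of the alternating words. -/
def act : FreeThreeGradedAss Φ X →ₐ[Φ] Module.End Φ (List (Σ σ, X σ) →₀ Φ) :=
  lift (consMap Φ) (by
    intro σ x x'
    ext1 l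
    ext1
    -- The defining relations act as `0` because two adjacent letters of equal polarity are never
    -- part of an alternating word.
    have h : ¬ Alternating ((⟨σ, x⟩ : Σ σ, X σ) :: ⟨σ, x'⟩ :: l) := fun k => by
      simp [Alternating] at k
    simp only [LinearMap.comp_apply, Module.End.mul_apply, Finsupp.lsingle_apply]
    rw [show consMap Φ (⟨σ, x'⟩ : Σ σ, X σ) (Finsupp.single l 1) =
      normalWord Φ ((⟨σ, x'⟩ : Σ σ, X σ) :: l) by simp [consMap], consMap_normalWord,
      normalWord, if_neg h]
    simp)

variable (X) in
/-- The coefficients in the basis of alternating words. -/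
def coeff : FreeThreeGradedAss Φ X →ₗ[Φ] (List (Σ σ, X σ) →₀ Φ) :=
  LinearMap.applyₗ (Finsupp.single [] 1) ∘ₗ (act Φ X).toLinearMap

/-- Acting on the empty word spells out `l` letter by letter. In particular the alternating words
are linearly independent. -/
theorem coeff_mon (l : List (Σ σ, X σ)) : coeff Φ X (mon Φ l) = normalWord Φ l := by
  change act Φ X (mon Φ l) (Finsupp.single [] 1) = _
  induction l with
  | nil => simp [mon, normalWord, Alternating]
  | cons x l ih =>
    rw [mon_cons, map_mul, Module.End.mul_apply, ih, act, lift_var, consMap_normalWord]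

/-- Such a word has two adjacent letters of equal polarity, whose product is `0`. -/
theorem mon_eq_zero {l : List (Σ σ, X σ)} (h : ¬ Alternating l) : mon Φ l = 0 := by
  induction l with
  | nil => exact absurd List.IsChain.nil h
  | cons x l ih =>
    by_cases hl : Alternating l
    · cases l with
      | nil => exact absurd (List.IsChain.singleton _) h
      | cons y l =>
        obtain ⟨σ, x⟩ := x
        obtain ⟨τ, y⟩ := y
        have e : σ = τ := by
          by_contra e
          exact h (List.IsChain.cons_cons e hl)
        subst e
        rw [mon_cons, mon_cons, ← mul_assoc, var_mul_var, zero_mul]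
    · rw [mon_cons, ih hl, mul_zero]

/-- The span of a set of words. -/
def wordSpan (S : Set (List (Σ σ, X σ))) : Submodule Φ (FreeThreeGradedAss Φ X) :=
  Submodule.span Φ (mon Φ '' S)

theorem mon_mem_wordSpan {S : Set (List (Σ σ, X σ))} {l : List (Σ σ, X σ)} (h : l ∈ S) :
    mon Φ l ∈ wordSpan Φ S := Submodule.subset_span ⟨l, h, rfl⟩

theorem wordSpan_mono {S T : Set (List (Σ σ, X σ))} (h : S ⊆ T) : wordSpan Φ S ≤ wordSpan Φ T :=
  Submodule.span_mono (Set.image_mono h)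

theorem mem_wordSpan_univ (a : FreeThreeGradedAss Φ X) : a ∈ wordSpan Φ Set.univ := by
  obtain ⟨a, rfl⟩ := RingQuot.mkAlgHom_surjective Φ (AssRel Φ X) a
  have hone : ∀ r : Φ, algebraMap Φ (FreeThreeGradedAss Φ X) r ∈ wordSpan Φ Set.univ := fun r => by
    rw [Algebra.algebraMap_eq_smul_one]
    exact Submodule.smul_mem _ r (mon_mem_wordSpan Φ (Set.mem_univ []))
  induction a using FreeAlgebra.induction with
  | grade0 r => rw [AlgHom.commutes]; exact hone r
  | grade1 x =>
    have h := mon_mem_wordSpan Φ (Set.mem_univ [x])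
    rwa [mon_singleton] at h
  | mul a b ha hb =>
    rw [map_mul]
    have h := Submodule.mul_mem_mul ha hb
    rw [wordSpan, Submodule.span_mul_span] at h
    refine Submodule.span_mono ?_ h
    rintro _ ⟨_, ⟨l, -, rfl⟩, _, ⟨l', -, rfl⟩, rfl⟩
    exact ⟨l ++ l', trivial, mon_append Φ l l'⟩
  | add a b ha hb => rw [map_add]; exact add_mem ha hb

/-- By linearity it is enough to check words, which span; the non-alternating ones vanish on both
sides. -/
theorem linearCombination_coeff (a : FreeThreeGradedAss Φ X) :
    Finsupp.linearCombination Φ (mon Φ) (coeff Φ X a) = a := by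
  have ha := mem_wordSpan_univ Φ a
  induction ha using Submodule.span_induction with
  | mem a ha =>
    obtain ⟨l, -, rfl⟩ := ha
    rw [coeff_mon]
    by_cases h : Alternating l
    · simp [normalWord, h]
    · simp [normalWord, h, mon_eq_zero Φ h]
  | zero => simp
  | add a b _ _ ha hb => rw [map_add, map_add, ha, hb]
  | smul r a _ ha => rw [map_smul, map_smul, ha]

theorem coeff_mem_supported {S : Set (List (Σ σ, X σ))} {a : FreeThreeGradedAss Φ X}
    (ha : a ∈ wordSpan Φ S) :
    coeff Φ X a ∈ Finsupp.supported Φ Φ (S ∩ {l | Alternating l}) := by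
  induction ha using Submodule.span_induction with
  | mem a ha =>
    obtain ⟨l, hl, rfl⟩ := ha
    rw [coeff_mon]
    by_cases h : Alternating l
    · rw [normalWord, if_pos h]
      exact Finsupp.single_mem_supported Φ 1 ⟨hl, h⟩
    · rw [normalWord, if_neg h]
      exact zero_mem _
  | zero => simp
  | add a b _ _ ha hb => rw [map_add]; exact add_mem ha hb
  | smul r a _ ha => rw [map_smul]; exact Submodule.smul_mem _ r ha

/-- The coefficients of `a` would be supported in two disjoint sets. This is used for words sorted
by weight and for words sorted by parity of length. -/
theorem eq_zero_of_mem_wordSpan {S T : Set (List (Σ σ, X σ))} (h : Disjoint S T)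
    {a : FreeThreeGradedAss Φ X} (hS : a ∈ wordSpan Φ S) (hT : a ∈ wordSpan Φ T) : a = 0 := by
  have h1 := coeff_mem_supported Φ hS
  have h2 := coeff_mem_supported Φ hT
  have hd := Finsupp.disjoint_supported_supported (M := Φ) (R := Φ)
    (h.mono (Set.inter_subset_left (t := {l | Alternating l}))
      (Set.inter_subset_left (t := {l | Alternating l})))
  rw [← linearCombination_coeff Φ a, Submodule.disjoint_def.1 hd _ h1 h2, map_zero]

theorem alternating_of_mem_support {a : FreeThreeGradedAss Φ X} {l : List (Σ σ, X σ)}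
    (h : l ∈ (coeff Φ X a).support) : Alternating l :=
  ((Finsupp.mem_supported Φ _).1 (coeff_mem_supported Φ (mem_wordSpan_univ Φ a)) h).2

/-- Words of different weights are different words. This supplies the independence of degrees that
`IsTripleMap.map_toJordan` requires. -/
theorem eq_zero_of_add_eq_zero :
    ∀ a ∈ part Φ X 1, ∀ b ∈ part Φ X 0, ∀ c ∈ part Φ X (-1),
      a + b + c = 0 → a = 0 ∧ b = 0 ∧ c = 0 := by
  intro a ha b hb c hc h
  have key : ∀ (n p q : ℤ), p ≠ n → q ≠ n → ∀ u ∈ part Φ X n, ∀ v ∈ part Φ X p,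
      ∀ w ∈ part Φ X q, u + v + w = 0 → u = 0 := by
    intro n p q hp hq u hu v hv w hw h
    refine eq_zero_of_mem_wordSpan Φ (S := {l | weight l = n}) (T := {l | weight l ≠ n})
      (Set.disjoint_left.2 fun l h k => k h) hu ?_
    rw [eq_neg_of_add_eq_zero_left ((add_assoc u v w).symm.trans h)]
    exact neg_mem (add_mem
      (wordSpan_mono Φ (fun l (k : weight l = p) => (k.trans_ne hp :)) hv)
      (wordSpan_mono Φ (fun l (k : weight l = q) => (k.trans_ne hq :)) hw))
  exact ⟨key 1 0 (-1) (by decide) (by decide) a ha b hb c hc h,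
    key 0 1 (-1) (by decide) (by decide) b hb a ha c hc (by rw [add_comm b]; exact h),
    key (-1) 1 0 (by decide) (by decide) c hc a ha b hb (by rw [add_assoc, add_comm]; exact h)⟩

end Words

/-! ### The images of Lie and Jordan polynomials in the free 3-graded associative algebra -/

section Jordan

variable {Φ : Type*} [CommRing Φ]

theorem ofAssociative_Q {A : Type*} [Ring A] [Algebra Φ A] {σ τ : Bool} (h : σ ≠ τ) (x y : A) :
    (JordanPair.ofAssociative Φ A).Q h x y = x * y * x := rfl

theorem ofAssociative_tri {A : Type*} [Ring A] [Algebra Φ A] {σ τ : Bool} (h : σ ≠ τ)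
    (x y z : A) :
    (JordanPair.ofAssociative Φ A).tri h x y z = x * y * z + z * y * x := by
  simp only [QuadraticPair.tri, ofAssociative_Q]
  noncomm_ring

variable {X : Bool → Type*}

/-- The target pair is built on all of `Ass`, so the degree must be tracked: `Q_s t = s t s` has
degree `σ1 + τ1 + σ1 = σ1`. -/
theorem eval_mem_part {σ : Bool} (t : Term Φ X σ) :
    FreeJordanPair.eval (JordanPair.ofAssociative Φ (FreeThreeGradedAss Φ X))
      (fun σ x => var Φ ⟨σ, x⟩) t ∈ part Φ X (sgn σ) := by
  induction t with
  | var x => exact var_mem_part Φ x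
  | zero => exact zero_mem _
  | add s t hs ht => exact add_mem hs ht
  | neg t ht => exact neg_mem ht
  | smul r t ht => exact Submodule.smul_mem _ r ht
  | @quad σ τ h s t hs ht =>
    have := part_mul Φ _ _ _ _ (part_mul Φ _ _ _ _ hs ht) hs
    rw [FreeThreeGradedLie.sgn_add_sgn h, zero_add] at this
    exact this

theorem ofJordan_mem_part {σ : Bool} (g : FreeJordanPair Φ X σ) :
    (ofJordan Φ X).map σ g ∈ part Φ X (sgn σ) := by
  obtain ⟨t⟩ := g
  exact eval_mem_part t

/-- Expanding, `[[a, b], c] = abc - bac - cab + cba`. The middle terms vanish because `ac` and `ca`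
have degree `±2`, and what remains is the Jordan triple product. -/
theorem isTripleMap_ofJordan :
    IsTripleMap (V := FreeJordanPair Φ X) (FreeJordanPair.pair Φ X) (part Φ X)
      (fun σ => (ofJordan Φ X).map σ) where
  mem _ := ofJordan_mem_part
  map_tri {σ τ} h x y z := by
    refine ((ofJordan Φ X).map_tri h x y z).trans ?_
    rw [ofAssociative_tri h]
    have hz : ∀ u v : FreeJordanPair Φ X σ,
        ((ofJordan Φ X).map σ u * (ofJordan Φ X).map σ v : FreeThreeGradedAss Φ X) = 0 := by
      intro u v
      have k := part_mul Φ _ _ _ _ (ofJordan_mem_part u) (ofJordan_mem_part v)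
      rwa [(hasThreeGradedBracket Φ X).eq_bot _ (by cases σ <;> decide) (by cases σ <;> decide)
        (by cases σ <;> decide), Submodule.mem_bot] at k
    have h1 := hz x z
    have h2 := hz z x
    generalize (ofJordan Φ X).map σ x = a at *
    generalize (ofJordan Φ X).map τ y = b at *
    generalize (ofJordan Φ X).map σ z = c at *
    change (a * b * c + c * b * a : FreeThreeGradedAss Φ X) = _
    simp only [LieRing.of_associative_ring_bracket, sub_mul, mul_sub]
    rw [mul_assoc b a c, h1, ← mul_assoc c a b, h2, mul_zero, zero_mul, ← mul_assoc]
    abel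

/-- The comparison with target `Ass` under commutators. It turns the image of a Jordan polynomial
into a computation with commutators of words. -/
theorem ofJordan_toJordan {σ : Bool} {f : FreeThreeGradedLie Φ X}
    (hf : f ∈ FreeThreeGradedLie.part Φ X (sgn σ)) :
    (ofJordan Φ X).map σ (toJordan Φ X σ f) = ofLie Φ X f :=
  isTripleMap_ofJordan.map_toJordan (hasThreeGradedBracket Φ X) (eq_zero_of_add_eq_zero Φ)
    (ofLie Φ X) (fun _ _ => FreeThreeGradedLie.lift_var ..) hf

theorem ofLie_var {σ : Bool} (x : X σ) :
    ofLie Φ X (FreeThreeGradedLie.var Φ x) = var Φ ⟨σ, x⟩ := FreeThreeGradedLie.lift_var ..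

theorem ofLie_mem_part {n : ℤ} {f : FreeThreeGradedLie Φ X}
    (hf : f ∈ FreeThreeGradedLie.part Φ X n) : ofLie Φ X f ∈ part Φ X n :=
  FreeThreeGradedLie.map_mem_of_mem_part (hasThreeGradedBracket Φ X) (ofLie Φ X)
    (fun _ x => by rw [ofLie_var]; exact var_mem_part Φ x) hf

variable {Y : Bool → Type*}

/-- The map on variables of either polarity given by maps `X^σ → Y^σ`. -/
def mapVar (i : ∀ σ, X σ → Y σ) (x : Σ σ, X σ) : Σ σ, Y σ := ⟨x.1, i x.1 x.2⟩

/-- The homomorphism `Ass[X^+, X^-] → Ass[Y^+, Y^-]` given by maps `X^σ → Y^σ`. -/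
def map (i : ∀ σ, X σ → Y σ) : FreeThreeGradedAss Φ X →ₐ[Φ] FreeThreeGradedAss Φ Y :=
  lift (fun x => var Φ (mapVar i x)) (fun _ _ _ => var_mul_var Φ _ _)

theorem map_var (i : ∀ σ, X σ → Y σ) (x : Σ σ, X σ) : map i (var Φ x) = var Φ (mapVar i x) :=
  lift_var ..

theorem map_mon (i : ∀ σ, X σ → Y σ) (l : List (Σ σ, X σ)) :
    map i (mon Φ l) = mon Φ (l.map (mapVar i)) := by
  induction l with
  | nil => simp [mon]
  | cons x l ih => rw [mon_cons, map_mul, ih, List.map_cons, mon_cons, map_var]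

theorem ofLie_map (i : ∀ σ, X σ → Y σ) (f : FreeThreeGradedLie Φ X) :
    ofLie Φ Y (FreeThreeGradedLie.map i f) = map i (ofLie Φ X f) := by
  have h : (ofLie Φ Y).comp (FreeThreeGradedLie.map i) =
      ((map i : FreeThreeGradedAss Φ X →ₐ[Φ] FreeThreeGradedAss Φ Y) :
        FreeThreeGradedAss Φ X →ₗ⁅Φ⁆ FreeThreeGradedAss Φ Y).comp (ofLie Φ X) := by
    refine FreeThreeGradedLie.hom_ext fun σ x => ?_
    simp only [LieHom.comp_apply, FreeThreeGradedLie.map_var, ofLie_var]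
    exact (map_var i ⟨σ, x⟩).symm
  exact LieHom.congr_fun h f

/-- The constant term. -/
def constantTerm : FreeThreeGradedAss Φ X →ₐ[Φ] Φ :=
  lift (fun _ => 0) (fun _ _ _ => zero_mul _)

/-- The constant term is a Lie homomorphism into the abelian Lie algebra `Φ` and kills the
variables. This excludes the empty word, whose commutator with `y^+ + y^-` would be `0`, as a
leading word. -/
theorem constantTerm_ofLie (f : FreeThreeGradedLie Φ X) : constantTerm (ofLie Φ X f) = 0 := by
  have h : ((constantTerm : FreeThreeGradedAss Φ X →ₐ[Φ] Φ) :
      FreeThreeGradedAss Φ X →ₗ⁅Φ⁆ Φ).comp (ofLie Φ X) = 0 := by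
    refine FreeThreeGradedLie.hom_ext fun σ x => ?_
    simp only [LieHom.comp_apply, ofLie_var]
    exact lift_var (fun _ => (0 : Φ)) (fun _ _ _ => zero_mul _) ⟨σ, x⟩
  exact LieHom.congr_fun h f

theorem constantTerm_sum (c : List (Σ σ, X σ) →₀ Φ) :
    constantTerm (c.sum fun l r => r • mon Φ l) = c [] := by
  classical
  have h : ∀ l : List (Σ σ, X σ), constantTerm (mon Φ l) = if l = [] then 1 else 0 := by
    intro l
    cases l with
    | nil => simp [mon]
    | cons x l => rw [mon_cons, map_mul, constantTerm, lift_var]; simp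
  rw [Finsupp.sum, map_sum]
  simp [h, eq_comm]

end Jordan

/-! ### Leading terms after commutation with new variables -/

section Leading

variable {Φ : Type*} [CommRing Φ] {X Y : Bool → Type*}

theorem mapVar_injective (i : ∀ σ, X σ ↪ Y σ) :
    Function.Injective (mapVar fun σ => (i σ : X σ → Y σ)) := by
  rintro ⟨σ, x⟩ ⟨τ, x'⟩ h
  obtain ⟨rfl, h⟩ := Sigma.mk.inj_iff.1 h
  exact congrArg (Sigma.mk σ) ((i σ).injective (eq_of_heq h))

open Classical in
theorem normalWord_apply {l u : List (Σ σ, X σ)} (hu : Alternating u) :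
    normalWord Φ l u = if l = u then 1 else 0 := by
  by_cases h : l = u
  · subst h; simp [normalWord, hu]
  · by_cases hl : Alternating l <;> simp [normalWord, hl, h]

/-- The contribution of the word `l` of `f` to the Jordan polynomial: the word itself if its length
is odd, and its commutator with `y^+ + y^-` if its length is even. -/
def jordanWord (i : ∀ σ, X σ → Y σ) (y : ∀ σ, Y σ) (l : List (Σ σ, X σ)) :
    FreeThreeGradedAss Φ Y :=
  if Even l.length then
    mon Φ (l.map (mapVar i) ++ [⟨true, y true⟩]) + mon Φ (l.map (mapVar i) ++ [⟨false, y false⟩]) -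
      mon Φ (⟨true, y true⟩ :: l.map (mapVar i)) - mon Φ (⟨false, y false⟩ :: l.map (mapVar i))
  else mon Φ (l.map (mapVar i))

/-- All words written in `jordanWord` have exactly the length given by the bound. -/
theorem length_le_of_coeff_jordanWord_ne_zero (i : ∀ σ, X σ → Y σ) (y : ∀ σ, Y σ)
    {l : List (Σ σ, X σ)} {u : List (Σ σ, Y σ)}
    (h : coeff Φ Y (jordanWord i y l) u ≠ 0) :
    u.length ≤ if Even l.length then l.length + 1 else l.length := by
  classical
  have hu : Alternating u := alternating_of_mem_support Φ (Finsupp.mem_support_iff.2 h)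
  by_contra hlt
  apply h
  rw [jordanWord]
  split_ifs at hlt ⊢ with he
  · have h1 : ∀ s, l.map (mapVar i) ++ [⟨s, y s⟩] ≠ u := by rintro s rfl; simp at hlt
    have h2 : ∀ s, (⟨s, y s⟩ :: l.map (mapVar i) : List (Σ σ, Y σ)) ≠ u := by
      rintro s rfl; simp at hlt
    simp [coeff_mon, normalWord_apply hu, h1, h2]
  · have h1 : l.map (mapVar i) ≠ u := by rintro rfl; simp at hlt
    simp [coeff_mon, normalWord_apply hu, h1]

theorem notMem_map_mapVar {i : ∀ σ, X σ ↪ Y σ} {y : ∀ σ, Y σ}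
    (hy : ∀ σ, y σ ∉ Set.range (i σ)) (σ : Bool) (l : List (Σ σ, X σ)) :
    (⟨σ, y σ⟩ : Σ σ, Y σ) ∉ l.map (mapVar fun σ => i σ) := by
  intro h
  obtain ⟨⟨τ, x⟩, -, h⟩ := List.mem_map.1 h
  obtain ⟨rfl, h⟩ := Sigma.mk.inj_iff.1 h
  exact hy _ ⟨x, eq_of_heq h⟩

theorem alternating_map {i : ∀ σ, X σ → Y σ} {l : List (Σ σ, X σ)} (h : Alternating l) :
    Alternating (l.map (mapVar i)) :=
  (List.isChain_map _).2 h

-- Words coming from commutators contain a new variable, which the image of `l₀` does not; the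
-- remaining words are told apart by injectivity of `i`.
open Classical in
theorem coeff_jordanWord_of_odd {i : ∀ σ, X σ ↪ Y σ} {y : ∀ σ, Y σ}
    (hy : ∀ σ, y σ ∉ Set.range (i σ)) {l₀ : List (Σ σ, X σ)} (hl₀ : Alternating l₀)
    (h₀ : ¬ Even l₀.length) (l : List (Σ σ, X σ)) :
    coeff Φ Y (jordanWord (fun σ => i σ) y l) (l₀.map (mapVar fun σ => i σ)) =
      if l = l₀ then 1 else 0 := by
  have hu := alternating_map (i := fun σ => (i σ : X σ → Y σ)) hl₀
  have hn := fun σ => notMem_map_mapVar hy σ l₀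
  have hi := List.map_injective_iff.2 (mapVar_injective i)
  rw [jordanWord]
  split_ifs with he hl hl
  · exact absurd (hl ▸ he) h₀
  · have h1 : ∀ s, l.map (mapVar fun σ => i σ) ++ [⟨s, y s⟩] ≠
        l₀.map (mapVar fun σ => i σ) := by
      intro s h; apply hn s; rw [← h]; simp
    have h2 : ∀ s, (⟨s, y s⟩ :: l.map (mapVar fun σ => i σ) : List (Σ σ, Y σ)) ≠
        l₀.map (mapVar fun σ => i σ) := by
      intro s h; apply hn s; rw [← h]; simp
    simp [coeff_mon, normalWord_apply hu, h1, h2]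
  · simp [coeff_mon, normalWord_apply hu, hl]
  · simp [coeff_mon, normalWord_apply hu, hi.eq_iff, hl]

-- The word is `u = l₀ y^τ`. A word that starts with a new variable differs from `u`, whose first
-- letter is old because `l₀` is nonempty. Among the words that end in a new variable, deleting the
-- last letter recovers `l₀`.
open Classical in
theorem exists_coeff_jordanWord_of_even {i : ∀ σ, X σ ↪ Y σ} {y : ∀ σ, Y σ}
    (hy : ∀ σ, y σ ∉ Set.range (i σ)) {l₀ : List (Σ σ, X σ)} (hl₀ : Alternating l₀)
    (h₀ : Even l₀.length) (hne : l₀ ≠ []) :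
    ∃ u : List (Σ σ, Y σ), u.length = l₀.length + 1 ∧ ∀ l,
      coeff Φ Y (jordanWord (fun σ => i σ) y l) u = if l = l₀ then 1 else 0 := by
  have hi := List.map_injective_iff.2 (mapVar_injective i)
  -- The polarity opposite to the last letter of `l₀` makes `l₀ y^τ` alternating; the other choice
  -- would give `0`.
  obtain ⟨τ, hτ⟩ : ∃ τ, (l₀.getLast hne).1 ≠ τ := ⟨_, (Bool.not_ne_self _).symm⟩
  have hu : Alternating (l₀.map (mapVar fun σ => i σ) ++ [⟨τ, y τ⟩]) := by
    refine List.isChain_append.2 ⟨alternating_map hl₀, List.isChain_singleton _, ?_⟩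
    intro a ha b hb
    rw [List.getLast?_map, List.getLast?_eq_some_getLast hne] at ha
    simp only [Option.map_some, Option.mem_some_iff, List.head?_cons] at ha hb
    subst ha hb
    exact hτ
  refine ⟨l₀.map (mapVar fun σ => i σ) ++ [⟨τ, y τ⟩], by simp, fun l => ?_⟩
  rw [jordanWord]
  split_ifs with he hl hl
  · subst hl
    have h1 : ∀ s, (⟨s, y s⟩ :: l.map (mapVar fun σ => i σ) : List (Σ σ, Y σ)) ≠
        l.map (mapVar fun σ => i σ) ++ [⟨τ, y τ⟩] := by
      intro s h
      obtain ⟨a, l, rfl⟩ := List.exists_cons_of_ne_nil hne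
      rw [List.map_cons, List.cons_append, List.cons.injEq] at h
      exact notMem_map_mapVar hy s [a] (by simp [h.1])
    simp only [map_sub, map_add, Finsupp.sub_apply, Finsupp.add_apply, coeff_mon,
      normalWord_apply hu, h1]
    -- Of the two words `l y^+` and `l y^-`, exactly one is `u`.
    cases τ <;> simp
  · have h1 : ∀ s, (⟨s, y s⟩ :: l.map (mapVar fun σ => i σ) : List (Σ σ, Y σ)) ≠
        l₀.map (mapVar fun σ => i σ) ++ [⟨τ, y τ⟩] := by
      intro s h
      obtain ⟨a, l', rfl⟩ := List.exists_cons_of_ne_nil hne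
      rw [List.map_cons, List.cons_append, List.cons.injEq] at h
      exact notMem_map_mapVar hy s [a] (by simp [h.1])
    have h2 : ∀ s, l.map (mapVar fun σ => i σ) ++ [⟨s, y s⟩] ≠
        l₀.map (mapVar fun σ => i σ) ++ [⟨τ, y τ⟩] := fun s h =>
      hl (hi (List.append_inj' h rfl).1)
    simp [coeff_mon, normalWord_apply hu, h1, h2]
  · exact absurd (hl ▸ h₀) he
  · have h1 : l.map (mapVar fun σ => i σ) ≠
        l₀.map (mapVar fun σ => i σ) ++ [⟨τ, y τ⟩] := by
      intro h; apply notMem_map_mapVar hy τ l; rw [h]; simp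
    simp [coeff_mon, normalWord_apply hu, h1]

/-- A combination with monic leading term keeps that property under `jordanWord`. -/
theorem hasMonicLeadingTerm_sum_jordanWord {i : ∀ σ, X σ ↪ Y σ} {y : ∀ σ, Y σ}
    (hy : ∀ σ, y σ ∉ Set.range (i σ)) {c : List (Σ σ, X σ) →₀ Φ} (hc0 : c [] = 0)
    (hc : ∀ l ∈ c.support, Alternating l) {l₀ : List (Σ σ, X σ)} (hl₀ : l₀ ∈ c.support)
    (h1 : c l₀ = 1) (hmax : ∀ l ∈ c.support, l.length ≤ l₀.length) :
    (c.sum fun l r => r • jordanWord (Φ := Φ) (fun σ => i σ) y l) ≠ 0 ∧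
      (c.sum fun l r => r • jordanWord (Φ := Φ) (fun σ => i σ) y l).HasMonicLeadingTerm := by
  classical
  set A := c.sum fun l r => r • jordanWord (Φ := Φ) (fun σ => i σ) y l with hA
  have hcoeff : ∀ u, coeff Φ Y A u =
      ∑ l ∈ c.support, c l * coeff Φ Y (jordanWord (fun σ => i σ) y l) u := by
    intro u
    simp [hA, Finsupp.sum, map_sum, Finsupp.finsetSum_apply]
  -- A coefficient `1` on the support makes `Φ` nontrivial.
  have hnz : (1 : Φ) ≠ 0 := h1 ▸ Finsupp.mem_support_iff.1 hl₀
  obtain ⟨u, hlen, hu⟩ : ∃ u : List (Σ σ, Y σ),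
      u.length = (if Even l₀.length then l₀.length + 1 else l₀.length) ∧ ∀ l,
        coeff Φ Y (jordanWord (fun σ => i σ) y l) u = if l = l₀ then 1 else 0 := by
    by_cases he : Even l₀.length
    · rw [if_pos he]
      exact exists_coeff_jordanWord_of_even hy (hc _ hl₀) he fun h => by
        rw [h, hc0] at h1; exact hnz h1.symm
    · rw [if_neg he]
      exact ⟨_, List.length_map _, coeff_jordanWord_of_odd hy (hc _ hl₀) he⟩
  have hAu : coeff Φ Y A u = 1 := by
    rw [hcoeff, Finset.sum_eq_single_of_mem l₀ hl₀ (fun l _ h => by rw [hu, if_neg h, mul_zero]),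
      hu, if_pos rfl, mul_one, h1]
  refine ⟨fun h => hnz ?_, coeff Φ Y A, fun l => alternating_of_mem_support Φ,
    (linearCombination_coeff Φ A).symm, u, ?_, hAu, fun v hv => ?_⟩
  · rw [← hAu, h, map_zero, Finsupp.zero_apply]
  · rw [Finsupp.mem_support_iff, hAu]; exact hnz
  · rw [Finsupp.mem_support_iff, hcoeff] at hv
    obtain ⟨l, hl, hlv⟩ := Finset.exists_ne_zero_of_sum_ne_zero hv
    have := length_le_of_coeff_jordanWord_ne_zero _ _ (right_ne_zero_of_mul hlv)
    have hm := hmax l hl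
    rw [hlen]
    refine this.trans ?_
    -- The critical case is `l` even and `l₀` odd: the parities differ, so `l` is strictly shorter
    -- than `l₀`, which leaves room for its extra letter.
    split_ifs with ha hb hb
    · omega
    · rcases hm.lt_or_eq with h | h
      · omega
      · exact absurd (h ▸ ha) hb
    · omega
    · exact hm

/-- The components of even and odd degree of `f_1 + f_0 + f_{-1}`. -/
theorem eq_sum_of_parity {a1 a0 am : FreeThreeGradedAss Φ X} (h1 : a1 ∈ part Φ X 1)
    (h0 : a0 ∈ part Φ X 0) (hm : am ∈ part Φ X (-1)) {c : List (Σ σ, X σ) →₀ Φ}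
    (h : a1 + a0 + am = c.sum fun l r => r • mon Φ l) :
    a0 = (c.sum fun l r => r • if Even l.length then mon Φ l else 0) ∧
      a1 + am = c.sum fun l r => r • if Even l.length then 0 else mon Φ l := by
  set E := c.sum fun l r => r • if Even l.length then mon Φ l else 0 with hE
  set O := c.sum fun l r => r • if Even l.length then 0 else mon Φ l with hO
  have hsum : a1 + a0 + am = E + O := by
    rw [h, hE, hO, ← Finsupp.sum_add]
    refine Finsupp.sum_congr fun l _ => ?_
    split_ifs <;> simp
  let S : Set (List (Σ σ, X σ)) := {l | Even l.length}
  have hE' : E ∈ wordSpan Φ S := Submodule.sum_mem _ fun l _ => Submodule.smul_mem _ _ <| by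
    split_ifs with k
    exacts [mon_mem_wordSpan Φ k, zero_mem _]
  have hO' : O ∈ wordSpan Φ Sᶜ := Submodule.sum_mem _ fun l _ => Submodule.smul_mem _ _ <| by
    split_ifs with k
    exacts [zero_mem _, mon_mem_wordSpan Φ k]
  have hS : ∀ n : ℤ, Even n → part Φ X n ≤ wordSpan Φ S := fun n hn =>
    wordSpan_mono Φ fun l (k : weight l = n) => (even_weight l).1 (k ▸ hn)
  have hS' : ∀ n : ℤ, ¬ Even n → part Φ X n ≤ wordSpan Φ Sᶜ := fun n hn =>
    wordSpan_mono Φ fun l (k : weight l = n) h => hn (k ▸ (even_weight l).2 h)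
  -- This element lies in the span of the even words by the left side and in that of the odd words
  -- by the right side, so it is `0`.
  have e : a0 - E = O - (a1 + am) := by
    rw [sub_eq_sub_iff_add_eq_add, add_comm O, ← hsum]; abel
  have hz : a0 - E = 0 := eq_zero_of_mem_wordSpan Φ disjoint_compl_right
    (sub_mem (hS 0 (by decide) h0) hE')
    (e ▸ sub_mem hO' (add_mem (hS' 1 (by decide) h1) (hS' (-1) (by decide) hm)))
  exact ⟨sub_eq_zero.1 hz, (sub_eq_zero.1 (e ▸ hz)).symm⟩

end Leading

end FreeThreeGradedAss

/-! ### Essentiality of the Jordan polynomial -/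

open FreeThreeGradedAss in
theorem isEssentialJordan_jordanPolynomial {Φ : Type*} [CommRing Φ] {X Y : Bool → Type*}
    {f1 f0 fm : FreeThreeGradedLie Φ X} (hf1 : f1 ∈ FreeThreeGradedLie.part Φ X 1)
    (hf0 : f0 ∈ FreeThreeGradedLie.part Φ X 0) (hfm : fm ∈ FreeThreeGradedLie.part Φ X (-1))
    (hess : IsEssential (f1 + f0 + fm)) (i : ∀ σ, X σ ↪ Y σ) (y : ∀ σ, Y σ)
    (hy : ∀ σ, y σ ∉ Set.range (i σ)) :
    IsEssentialJordan (jordanPolynomial (FreeThreeGradedLie.map (fun σ => i σ) f1)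
      (FreeThreeGradedLie.map (fun σ => i σ) f0) (FreeThreeGradedLie.map (fun σ => i σ) fm) y) := by
  obtain ⟨-, c, hc, he, l₀, hl₀, h1, hmax⟩ := hess
  have hc0 : c [] = 0 := by rw [← constantTerm_sum, ← he, constantTerm_ofLie]
  rw [map_add, map_add] at he
  obtain ⟨hE, hO⟩ := eq_sum_of_parity (ofLie_mem_part hf1) (ofLie_mem_part hf0)
    (ofLie_mem_part hfm) he
  have hdeg := FreeThreeGradedLie.map_mem_part (fun σ => i σ) hf0
  have hv : ∀ σ, ⁅FreeThreeGradedLie.map (fun σ => (i σ : X σ → Y σ)) f0,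
      FreeThreeGradedLie.var Φ (y σ)⁆ ∈ FreeThreeGradedLie.part Φ Y (sgn σ) := fun σ => by
    simpa using FreeThreeGradedLie.lie_mem_part hdeg (FreeThreeGradedLie.var_mem_part (y σ))
  -- The image of `g` is `π(f_1) + π(f_{-1}) + [π(f_0), y^+ + y^-]`. The cross terms with the wrong
  -- polarity need no separate treatment: they are non-alternating words, and these are `0` in
  -- `Ass`.
  have key : (ofJordan Φ Y).map true (toJordan Φ Y true
        (FreeThreeGradedLie.map (fun σ => (i σ : X σ → Y σ)) f1 +
          ⁅FreeThreeGradedLie.map (fun σ => (i σ : X σ → Y σ)) f0,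
            FreeThreeGradedLie.var Φ (y true)⁆)) +
      (ofJordan Φ Y).map false (toJordan Φ Y false
        (FreeThreeGradedLie.map (fun σ => (i σ : X σ → Y σ)) fm +
          ⁅FreeThreeGradedLie.map (fun σ => (i σ : X σ → Y σ)) f0,
            FreeThreeGradedLie.var Φ (y false)⁆)) =
      c.sum fun l r => r • jordanWord (Φ := Φ) (fun σ => i σ) y l := by
    rw [ofJordan_toJordan (σ := true) (add_mem (FreeThreeGradedLie.map_mem_part _ hf1) (hv true)),
      ofJordan_toJordan (σ := false) (add_mem (FreeThreeGradedLie.map_mem_part _ hfm) (hv false))]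
    simp only [map_add, LieHom.map_lie, ofLie_map, ofLie_var,
      LieRing.of_associative_ring_bracket]
    set e := var Φ (⟨true, y true⟩ : Σ σ, Y σ) + var Φ ⟨false, y false⟩ with he
    -- Written through the even and odd truncations of a word, `jordanWord` can be summed against
    -- `c` using the parity decomposition of `f`.
    have : ∀ l : List (Σ σ, X σ), jordanWord (Φ := Φ) (fun σ => (i σ : X σ → Y σ)) y l =
        map (fun σ => i σ) (if Even l.length then 0 else mon Φ l) +
        (map (fun σ => i σ) (if Even l.length then mon Φ l else 0) * e -
          e * map (fun σ => i σ) (if Even l.length then mon Φ l else 0)) := by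
      intro l
      rw [jordanWord]
      split_ifs
      · simp only [mon_append, mon_singleton]
        simp only [mon_cons, map_mon, map_zero, he, mul_add, add_mul]
        abel
      · simp [map_mon]
    simp only [this, smul_add, smul_sub, Finsupp.sum_add, Finsupp.sum_sub]
    have hO' : map (fun σ => (i σ : X σ → Y σ)) (ofLie Φ X f1) +
        map (fun σ => (i σ : X σ → Y σ)) (ofLie Φ X fm) = c.sum fun l r =>
          r • map (fun σ => (i σ : X σ → Y σ)) (if Even l.length then 0 else mon Φ l) := by
      rw [← map_add, hO, Finsupp.sum, map_sum]
      simp only [map_smul]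
      rfl
    have hE' : map (fun σ => (i σ : X σ → Y σ)) (ofLie Φ X f0) = c.sum fun l r =>
          r • map (fun σ => (i σ : X σ → Y σ)) (if Even l.length then mon Φ l else 0) := by
      rw [hE, Finsupp.sum, map_sum]
      simp only [map_smul]
      rfl
    have hr := congrArg (· * e) hE'
    have hl := congrArg (e * ·) hE'
    simp only [Finsupp.sum, Finset.sum_mul, Finset.mul_sum, smul_mul_assoc,
      mul_smul_comm] at hr hl
    rw [← hO']
    simp only [Finsupp.sum]
    rw [← hr, ← hl, he]
    simp only [mul_add, add_mul]
    abel
  have H := hasMonicLeadingTerm_sum_jordanWord (i := i) (y := y) hy hc0 hc hl₀ h1 hmax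
  rw [← key] at H
  exact H

end JordanLie

theorem mainTheorem5 {Φ : Type*} [CommRing Φ] [Invertible (2 : Φ)]
    {L : Type*} [LieRing L] [LieAlgebra Φ L]
    (𝓛 : ℤ → Submodule Φ L) (h𝓛 : IsJordanThreeGrading 𝓛)
    (V : JordanPair Φ (GradedPair 𝓛)) (hV : IsAssociatedPair 𝓛 V)
    {X : Bool → Type*} (f1 f0 fm : FreeThreeGradedLie Φ X)
    (hf1 : f1 ∈ FreeThreeGradedLie.part Φ X 1)
    (hf0 : f0 ∈ FreeThreeGradedLie.part Φ X 0)
    (hfm : fm ∈ FreeThreeGradedLie.part Φ X (-1))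
    (hess : IsEssential (f1 + f0 + fm))
    (hid : IsGradedIdentity 𝓛 (f1 + f0 + fm))
    {Y : Bool → Type*} (i : ∀ σ, X σ ↪ Y σ)
    (y : ∀ σ, Y σ) (hy : ∀ σ, y σ ∉ Set.range (i σ)) :
    IsEssentialJordan (jordanPolynomial
        (FreeThreeGradedLie.map (fun σ => i σ) f1)
        (FreeThreeGradedLie.map (fun σ => i σ) f0)
        (FreeThreeGradedLie.map (fun σ => i σ) fm) y) ∧
      IsJordanIdentity V (jordanPolynomial
        (FreeThreeGradedLie.map (fun σ => i σ) f1)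
        (FreeThreeGradedLie.map (fun σ => i σ) f0)
        (FreeThreeGradedLie.map (fun σ => i σ) fm) y) := by
  exact ⟨isEssentialJordan_jordanPolynomial hf1 hf0 hfm hess i y hy,
    isJordanIdentity_jordanPolynomial h𝓛.toIsThreeGrading V hV hf1 hf0 hfm hid _ y⟩
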